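/- Let $G$ be a finite simple plane graph, i.e. a finite simple graph drawn in the Euclidean plane without crossings (vertices are distinct points, edges are polygonal arcs joining their ends, no edge passes through a vertex other than its ends, and distinct edges meet only in common ends); $G$ need not be connected. For $\kappa_1,\dots,\kappa_5\in\mathbb{N}\cup\{\infty\}$, a $\langle\kappa_1,\kappa_2,\kappa_3,\kappa_4,\kappa_5\rangle$-star in $G$ consists of a vertex $v$ of degree $5$ and its five neighbours, which can be listed as $v_1,\dots,v_5$ in a cyclic order around $v$ (clockwise or counterclockwise, starting from any neighbour) so that $\deg_G(v_i)\le\kappa_i$ for $i=1,\dots,5$. If $G$ has minimum degree exactly $5$ and has no vertex of degree $7,8,9,10$ or $11$, then $G$ contains a $\langle 5,6,6,5,\infty\rangle$-star, a $\langle 5,6,6,6,17\rangle$-star or a $\langle 6,6,6,6,6\rangle$-star. -/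

import Mathlib

/-- The subset of the Euclidean plane `ℂ` traced by the broken line with successive corners `l`. -/
def brokenLine : List ℂ → Set ℂ
  | [] => ∅
  | [a] => {a}
  | a :: b :: l => segment ℝ a b ∪ brokenLine (b :: l)

/-- The broken line with successive corners `l` does not meet itself: consecutive corners are
distinct, and each segment meets the rest of the broken line that follows it only in its own
endpoint. For two or more corners, such a broken line is a polygonal arc. -/
def IsSimpleBrokenLine : List ℂ → Prop
  | [] => True
  | [_] => True
  | a :: b :: l =>
      a ≠ b ∧ segment ℝ a b ∩ brokenLine (b :: l) = {b} ∧ IsSimpleBrokenLine (b :: l)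

/-- A drawing of the simple graph `G` in the Euclidean plane `ℂ` without crossings. The vertices
are distinct points, and every edge is a polygonal arc between its two ends. An edge is
traversed in two directions, one for each of its darts; `bend d` lists the corners strictly
between the two ends, in the order in which `d` traverses them. -/
structure PlaneDrawing {V : Type*} (G : SimpleGraph V) where
  /-- the point at which a vertex is drawn -/
  pos : V → ℂ
  /-- the inner corners of the arc of an edge, from `d.fst` to `d.snd` -/
  bend : G.Dart → List ℂ
  pos_injective : Function.Injective pos
  bend_symm : ∀ d : G.Dart, bend d.symm = (bend d).reverse
  /-- every edge is an arc -/
  isSimple : ∀ d : G.Dart, IsSimpleBrokenLine (pos d.fst :: (bend d ++ [pos d.snd]))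
  /-- no edge passes through a vertex other than its ends -/
  eq_of_pos_mem : ∀ (d : G.Dart) (v : V),
    pos v ∈ brokenLine (pos d.fst :: (bend d ++ [pos d.snd])) → v = d.fst ∨ v = d.snd
  /-- two different edges meet only in common ends -/
  inter_subset : ∀ d d' : G.Dart, d.edge ≠ d'.edge →
    brokenLine (pos d.fst :: (bend d ++ [pos d.snd])) ∩
        brokenLine (pos d'.fst :: (bend d' ++ [pos d'.snd])) ⊆
      {pos d.fst, pos d.snd} ∩ {pos d'.fst, pos d'.snd}

namespace PlaneDrawing

variable {V : Type*} {G : SimpleGraph V}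

/-- The direction, as an angle modulo `2π`, in which the arc of the dart `d` leaves the point of
the vertex `d.fst`: the direction from that point to the next corner of the arc. -/
noncomputable def angle (D : PlaneDrawing G) (d : G.Dart) : Real.Angle :=
  ((((D.bend d).headD (D.pos d.snd) - D.pos d.fst).arg : ℝ) : Real.Angle)

/-- The neighbours `x 0, …, x (k - 1)` of `v` occur in this cyclic order around `v` in the
drawing, in one of the two senses of rotation. -/
def InCyclicOrder (D : PlaneDrawing G) (v : V) {k : ℕ} (x : Fin k → G.neighborSet v) : Prop :=
  (∀ i j l : Fin k, i < j → j < l →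
      sbtw (D.angle (G.dartOfNeighborSet v (x i))) (D.angle (G.dartOfNeighborSet v (x j)))
        (D.angle (G.dartOfNeighborSet v (x l)))) ∨
    (∀ i j l : Fin k, i < j → j < l →
      sbtw (D.angle (G.dartOfNeighborSet v (x l))) (D.angle (G.dartOfNeighborSet v (x j)))
        (D.angle (G.dartOfNeighborSet v (x i))))

/-- The plane graph contains a `⟨κ 0, κ 1, κ 2, κ 3, κ 4⟩`-star: a vertex of degree five whose
five neighbours, in a cyclic order around it, have degrees at most `κ 0`, …, `κ 4`. -/
def HasStar [Fintype V] [DecidableRel G.Adj] (D : PlaneDrawing G) (κ : Fin 5 → ℕ∞) : Prop :=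
  ∃ v : V, G.degree v = 5 ∧
    ∃ x : Fin 5 → G.neighborSet v, Function.Injective x ∧ D.InCyclicOrder v x ∧
      ∀ i, (G.degree (x i : V) : ℕ∞) ≤ κ i

end PlaneDrawing

/-! The proof is by discharging. A vertex of degree k has charge k - 6 and each corner of a face of
length l has charge 2 - 6/l, so the total is 6(E - V - F), where F counts facial walks, and it is
negative as soon as E + 1 ≤ V + F (`sum_charge_neg`). All degrees are 5, 6 or at least 12, so only
vertices of degree 5 are in debt, by 1 each.

A vertex w of degree k ≥ 12 sends (k - 6)/k along each edge. A neighbour of degree 5 keeps this; at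
a neighbour of degree 6 it is split into halves that pass to the preceding and following neighbours
of w, if these have degree 5. Thus w never gives more than k - 6 (`sum_transfer_le`). Let v have
degree 5, and suppose that no star occurs. Some neighbour is large, or there is a ⟨6,6,6,6,6⟩-star.
Two large neighbours give 1/2 + 1/2, and so do a large neighbour and a non-triangular corner.
Otherwise one neighbour w is large and all corners are triangles, so the two neighbours of v beside
w are also beside v around w. If both have degree 6, v receives at least 1/2 · 2. If one has,
excluding ⟨5,6,6,6,17⟩ makes deg w ≥ 18 and v receives at least 2/3 · 3/2. Neither is impossible
without ⟨5,6,6,5,∞⟩ (`one_le_transfer`). All final charges are then nonnegative, a contradiction.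

The inequality E + 1 ≤ V + F comes from winding numbers instead of the Jordan curve theorem.
Circulations have dimension at least E - V + 1. The winding number of a circulation just to the left
of a dart is constant along facial walks and jumps across an edge by a nonzero multiple of the flow
there, so circulations embed into functions on the faces (`faceWinding_injective`). -/

/-! ### Continuous arguments in the complex plane -/

open Real in
/-- Continuous lifting of arguments: along a path in the slit plane the argument changes by the
amount predicted by any multiplicative decomposition into paths that start at `1`. -/
theorem Complex.arg_eq_add_sub_of_path {f g h : ℝ → ℂ} (hf : ContinuousOn f (Set.Icc 0 1))
    (hg : ContinuousOn g (Set.Icc 0 1)) (hh : ContinuousOn h (Set.Icc 0 1))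
    (hfs : ∀ t ∈ Set.Icc (0 : ℝ) 1, f t ∈ Complex.slitPlane)
    (hgs : ∀ t ∈ Set.Icc (0 : ℝ) 1, g t ∈ Complex.slitPlane)
    (hhs : ∀ t ∈ Set.Icc (0 : ℝ) 1, h t ∈ Complex.slitPlane)
    (hmul : ∀ t ∈ Set.Icc (0 : ℝ) 1, f t * h t = f 0 * g t) (hg0 : g 0 = 1) (hh0 : h 0 = 1) :
    (f 1).arg = (f 0).arg + (g 1).arg - (h 1).arg := by
  have h01 : (0 : ℝ) ∈ Set.Icc (0 : ℝ) 1 := by simp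
  have h11 : (1 : ℝ) ∈ Set.Icc (0 : ℝ) 1 := by simp
  set F : ℝ → ℝ := fun t => (f t).arg - (f 0).arg - (g t).arg + (h t).arg with hF
  have hcont : ContinuousOn F (Set.uIcc 0 1) := by
    rw [Set.uIcc_of_le zero_le_one]
    intro t ht
    have e1 := (Complex.continuousAt_arg (hfs t ht)).comp_continuousWithinAt (hf t ht)
    have e2 := (Complex.continuousAt_arg (hgs t ht)).comp_continuousWithinAt (hg t ht)
    have e3 := (Complex.continuousAt_arg (hhs t ht)).comp_continuousWithinAt (hh t ht)
    exact ((e1.sub continuousWithinAt_const).sub e2).add e3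
  have hF0 : F 0 = 0 := by simp [hF, hg0, hh0]
  have hdisc : ∀ t ∈ Set.Icc (0 : ℝ) 1, ∃ k : ℤ, F t = 2 * π * k := by
    intro t ht
    have n1 := Complex.slitPlane_ne_zero (hfs t ht)
    have n2 := Complex.slitPlane_ne_zero (hgs t ht)
    have n3 := Complex.slitPlane_ne_zero (hhs t ht)
    have n0 := Complex.slitPlane_ne_zero (hfs 0 h01)
    have e := congrArg (fun z : ℂ => (z.arg : Real.Angle)) (hmul t ht)
    simp only [Complex.arg_mul_coe_angle n1 n3, Complex.arg_mul_coe_angle n0 n2] at e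
    rw [← Real.Angle.coe_add, ← Real.Angle.coe_add,
      Real.Angle.angle_eq_iff_two_pi_dvd_sub] at e
    obtain ⟨k, hk⟩ := e
    exact ⟨k, by rw [← hk]; simp only [hF]; ring⟩
  -- `F` is continuous, starts at 0 and takes values in 2πℤ; leaving 0 would force it through π or
  -- -π.
  have hivt := intermediate_value_uIcc hcont
  rw [hF0, Set.uIcc_of_le (zero_le_one (α := ℝ))] at hivt
  obtain ⟨k, hk⟩ := hdisc 1 h11
  have hpi := Real.pi_pos
  have key : F 1 = 0 := by
    rcases lt_trichotomy k 0 with hk0 | hk0 | hk0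
    · exfalso
      have hk1 : (k : ℝ) ≤ -1 := by exact_mod_cast Int.le_sub_one_of_lt hk0
      have : -π ∈ Set.uIcc 0 (F 1) := by
        rw [hk, Set.uIcc_of_ge (by nlinarith)]; constructor <;> nlinarith
      obtain ⟨t, ht, hte⟩ := hivt this
      obtain ⟨m, hm⟩ := hdisc t ht
      have : (2 * m + 1 : ℝ) = 0 := by
        have : π * (2 * m + 1) = 0 := by linarith
        exact (mul_eq_zero.1 this).resolve_left hpi.ne'
      have : 2 * m + 1 = 0 := by exact_mod_cast this
      omega
    · simp [hk, hk0]
    · exfalso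
      have hk1 : (1 : ℝ) ≤ k := by exact_mod_cast hk0
      have : π ∈ Set.uIcc 0 (F 1) := by
        rw [hk, Set.uIcc_of_le (by nlinarith)]; constructor <;> nlinarith
      obtain ⟨t, ht, hte⟩ := hivt this
      obtain ⟨m, hm⟩ := hdisc t ht
      have : (2 * m - 1 : ℝ) = 0 := by
        have : π * (2 * m - 1) = 0 := by linarith
        exact (mul_eq_zero.1 this).resolve_left hpi.ne'
      have : 2 * m - 1 = 0 := by exact_mod_cast this
      omega
  simp only [hF] at key
  linarith

theorem Complex.exists_eq_neg_of_notMem_slitPlane {z : ℂ} (hz : z ∉ Complex.slitPlane) :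
    ∃ r : ℝ, 0 ≤ r ∧ z = -(r : ℂ) := by
  rw [Complex.mem_slitPlane_iff] at hz
  push Not at hz
  exact ⟨-z.re, by linarith [hz.1], by apply Complex.ext <;> simp [hz.2]⟩

/-- The two ends are seen in opposite directions only from points of the segment itself. -/
theorem Complex.div_mem_slitPlane_of_notMem_segment {a b p : ℂ} (hp : p ∉ segment ℝ a b) :
    (b - p) / (a - p) ∈ Complex.slitPlane := by
  by_contra h
  obtain ⟨r, hr, he⟩ := Complex.exists_eq_neg_of_notMem_slitPlane h
  have hap : a - p ≠ 0 := by
    intro h0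
    rw [sub_eq_zero] at h0
    exact hp (h0 ▸ left_mem_segment ℝ a b)
  rw [div_eq_iff hap] at he
  have hr1 : (1 + r : ℝ) ≠ 0 := by positivity
  have hr1' : (1 + r : ℂ) ≠ 0 := by exact_mod_cast hr1
  refine hp ⟨r / (1 + r), 1 / (1 + r), by positivity, by positivity, by field_simp; ring, ?_⟩
  simp only [Complex.real_smul]
  push_cast
  field_simp
  linear_combination he

theorem Complex.arg_inv_of_mem_slitPlane {z : ℂ} (hz : z ∈ Complex.slitPlane) :
    (z⁻¹).arg = -z.arg := by
  rw [Complex.arg_inv, if_neg (Complex.mem_slitPlane_iff_arg.1 hz).1]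

/-! ### Segments and the angles under which they are seen -/

/-- A family of oriented straight segments in the plane, closed under reversal, in which two
different segments meet only in common ends. -/
structure SegmentSystem (S : Type*) where
  /-- the starting point of a segment -/
  src : S → ℂ
  /-- the same segment with the opposite orientation -/
  rev : S → S
  rev_rev : ∀ s, rev (rev s) = s
  src_ne : ∀ s, src s ≠ src (rev s)
  meet : ∀ s t, t ≠ s → t ≠ rev s → ∀ p, p ∈ segment ℝ (src s) (src (rev s)) →
    p ∈ segment ℝ (src t) (src (rev t)) →
      (p = src s ∨ p = src (rev s)) ∧ (p = src t ∨ p = src (rev t))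

namespace SegmentSystem

variable {S : Type*} (Q : SegmentSystem S)

/-- The end point of a segment. -/
def tgt (s : S) : ℂ := Q.src (Q.rev s)

/-- The vector from the start to the end of a segment. -/
def vec (s : S) : ℂ := Q.tgt s - Q.src s

@[simp] theorem src_rev (s : S) : Q.src (Q.rev s) = Q.tgt s := rfl

@[simp] theorem tgt_rev (s : S) : Q.tgt (Q.rev s) = Q.src s := by simp [tgt, Q.rev_rev]

theorem vec_ne_zero (s : S) : Q.vec s ≠ 0 := sub_ne_zero.2 (Q.src_ne s).symm

theorem rev_injective : Function.Injective Q.rev :=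
  Function.LeftInverse.injective Q.rev_rev

theorem eq_of_src_eq_of_tgt_eq {s t : S} (h1 : Q.src t = Q.src s) (h2 : Q.tgt t = Q.tgt s) :
    t = s := by
  by_contra hne
  have hr : t ≠ Q.rev s := by
    rintro rfl
    exact Q.src_ne s h1.symm
  have hm : midpoint ℝ (Q.src s) (Q.tgt s) ∈ segment ℝ (Q.src s) (Q.tgt s) :=
    midpoint_mem_segment _ _
  have h := (Q.meet s t hne hr _ hm (by rw [src_rev, h1, h2]; exact hm)).1
  rcases h with h | h
  · exact Q.src_ne s ((midpoint_eq_left_iff (R := ℝ)).1 h)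
  · exact Q.src_ne s ((midpoint_eq_right_iff (R := ℝ)).1 h)

/-- Otherwise both segments leave the common start in the same direction, and the end of the shorter
one is a forbidden common point. -/
theorem neg_vec_div_vec_mem_slitPlane {s t : S} (h : Q.src t = Q.src s) (hne : t ≠ s) :
    -(Q.vec t / Q.vec s) ∈ Complex.slitPlane := by
  by_contra hz
  obtain ⟨r, hr, he⟩ := Complex.exists_eq_neg_of_notMem_slitPlane hz
  have he' : Q.vec t = r * Q.vec s := by
    rw [neg_inj, div_eq_iff (Q.vec_ne_zero s)] at he
    exact he
  have hrev : t ≠ Q.rev s := by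
    rintro rfl
    exact Q.src_ne s h.symm
  have hst := Q.src_ne s
  have htt := Q.src_ne t
  rw [src_rev] at hst htt
  simp only [vec, h] at he'
  rcases le_total r 1 with h1 | h1
  · have hmem : Q.tgt t ∈ segment ℝ (Q.src s) (Q.tgt s) := by
      refine ⟨1 - r, r, by linarith, hr, by ring, ?_⟩
      simp only [Complex.real_smul]
      push_cast
      linear_combination -he'
    rcases (Q.meet s t hne hrev _ hmem (right_mem_segment ℝ _ _)).1 with h' | h'
    · exact htt (h.trans h'.symm)
    · exact hne (Q.eq_of_src_eq_of_tgt_eq h h')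
  · have hr0 : (r : ℂ) ≠ 0 := by
      norm_cast; linarith
    have hmem : Q.tgt s ∈ segment ℝ (Q.src t) (Q.tgt t) := by
      refine ⟨1 - 1 / r, 1 / r, ?_, by positivity, by ring, ?_⟩
      · rw [sub_nonneg, div_le_one (by linarith)]; exact h1
      · simp only [Complex.real_smul, h]
        push_cast
        field_simp
        linear_combination he'
    rcases (Q.meet s t hne hrev _ (right_mem_segment ℝ _ _) hmem).2 with h' | h'
    · exact hst (h.symm.trans h'.symm)
    · exact hne (Q.eq_of_src_eq_of_tgt_eq h h'.symm)

open Classical in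
/-- The limit of the angle under which the segment `t` is seen from a point that approaches the
start of `s` along `s`, on the left-hand side of `s`. -/
noncomputable def sight (s t : S) : ℝ :=
  if Q.src t = Q.src s then (-(Q.vec t / Q.vec s)).arg
  else if Q.tgt t = Q.src s then -(-(Q.vec (Q.rev t) / Q.vec s)).arg
  else ((Q.tgt t - Q.src s) / (Q.src t - Q.src s)).arg

theorem src_notMem_segment {s t : S} (h1 : Q.src t ≠ Q.src s) (h2 : Q.tgt t ≠ Q.src s) :
    Q.src s ∉ segment ℝ (Q.src t) (Q.tgt t) := by
  intro hmem
  have hts : t ≠ s := by rintro rfl; exact h1 rfl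
  have htr : t ≠ Q.rev s := by rintro rfl; exact h2 (by simp)
  rcases (Q.meet s t hts htr _ (left_mem_segment ℝ _ _) hmem).2 with h | h
  · exact h1 h.symm
  · exact h2 h.symm

theorem sight_rev (s t : S) : Q.sight s (Q.rev t) = -Q.sight s t := by
  by_cases h1 : Q.src t = Q.src s
  · have h2 : Q.tgt t ≠ Q.src s := by
      rw [← h1]; exact (Q.src_ne t).symm
    simp [sight, h1, h2, Q.rev_rev]
  · by_cases h2 : Q.tgt t = Q.src s
    · simp [sight, h1, h2]
    · simp only [sight, src_rev, tgt_rev, if_neg h1, if_neg h2]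
      rw [← Complex.arg_inv_of_mem_slitPlane
        (Complex.div_mem_slitPlane_of_notMem_segment (Q.src_notMem_segment h1 h2)), inv_div]

/-- The angle under which the segment `s` is seen from `u`, up to orientation. -/
noncomputable def view (s : S) (u : ℂ) : ℝ := ((u - Q.tgt s) / (u - Q.src s)).arg

theorem mem_segment_of_mem_Icc {a b : ℂ} {t : ℝ} (ht : t ∈ Set.Icc (0 : ℝ) 1) :
    a + t * (b - a) ∈ segment ℝ a b :=
  ⟨1 - t, t, by linarith [ht.2], ht.1, by ring, by simp only [Complex.real_smul]; push_cast; ring⟩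

/-- While the observer moves from `a` towards `b`, the direction to `u` has turned by less than π;
its argument can therefore be followed continuously. -/
theorem div_mem_slitPlane_of_moving {a b u : ℂ} (hu : u ∉ segment ℝ a b) {t : ℝ}
    (ht : t ∈ Set.Icc (0 : ℝ) 1) :
    (u - (a + t * (b - a))) / (u - a) ∈ Complex.slitPlane := by
  have : u ∉ segment ℝ a (a + t * (b - a)) := fun h =>
    hu ((convex_segment a b).segment_subset (left_mem_segment ℝ a b)
      (mem_segment_of_mem_Icc ht) h)
  have := Complex.div_mem_slitPlane_of_notMem_segment this
  rwa [← neg_sub u a, ← neg_sub u (a + _), neg_div_neg_eq] at this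

/-- As the observer moves along `s`, the direction to the common start stays fixed, so only the
direction to the end of `t` turns. -/
theorem sight_sub_sight_of_src_eq {s t : S} (hne : t ≠ s) (h : Q.src t = Q.src s) :
    Q.sight (Q.rev s) t - Q.sight s t = Q.view s (Q.tgt t) - Q.view s (Q.src t) := by
  have hrev : t ≠ Q.rev s := by
    rintro rfl
    exact Q.src_ne s h.symm
  have hst : Q.src s ≠ Q.tgt s := Q.src_ne s
  have htt : Q.src t ≠ Q.tgt t := Q.src_ne t
  have h1 : Q.src t ≠ Q.tgt s := by rw [h]; exact hst
  have h2 : Q.tgt t ≠ Q.tgt s := fun h' => hne (Q.eq_of_src_eq_of_tgt_eq h h')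
  have hnm : Q.tgt t ∉ segment ℝ (Q.src s) (Q.tgt s) := by
    intro hmem
    rcases (Q.meet s t hne hrev _ hmem (right_mem_segment ℝ _ _)).1 with h' | h'
    · exact htt (h.trans h'.symm)
    · exact h2 h'
  have hslit := Q.neg_vec_div_vec_mem_slitPlane h hne
  have hv := Q.vec_ne_zero s
  have htv : Q.tgt t - Q.src s ≠ 0 := by rw [← h]; exact Q.vec_ne_zero t
  have key := Complex.arg_eq_add_sub_of_path
    (f := fun r : ℝ => (Q.tgt t - (Q.src s + r * (Q.tgt s - Q.src s))) / (Q.src s - Q.tgt s))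
    (g := fun r : ℝ => (Q.tgt t - (Q.src s + r * (Q.tgt s - Q.src s))) / (Q.tgt t - Q.src s))
    (h := fun _ => 1) (by fun_prop) (by fun_prop) (by fun_prop) ?_
    (fun r hr => div_mem_slitPlane_of_moving hnm hr) (by simp) ?_ (by simp [div_self htv]) rfl
  · have e : (Q.tgt t - (Q.src s + (1 : ℝ) * (Q.tgt s - Q.src s))) = Q.tgt t - Q.tgt s := by
      push_cast; ring
    have e0 : (Q.tgt t - (Q.src s + (0 : ℝ) * (Q.tgt s - Q.src s))) = Q.tgt t - Q.src s := by
      push_cast; ring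
    simp only [e, e0, Complex.arg_one, sub_zero] at key
    have e2 : -((Q.tgt t - Q.src s) / (Q.tgt s - Q.src s))
        = (Q.tgt t - Q.src s) / (Q.src s - Q.tgt s) := by
      rw [← neg_sub (Q.tgt s), div_neg]
    simp only [sight, src_rev, if_neg h2, view, vec, h, if_neg hst, e2, key]
    simp
  · intro r hr
    by_contra hz
    obtain ⟨q, hq, he⟩ := Complex.exists_eq_neg_of_notMem_slitPlane hz
    rw [div_eq_iff (sub_ne_zero.2 hst)] at he
    refine absurd hslit ?_
    have e2 : -(Q.vec t / Q.vec s) = ((-(r + q) : ℝ) : ℂ) := by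
      rw [← neg_div, div_eq_iff hv]
      simp only [vec, h]
      push_cast
      linear_combination -he
    rw [e2, Complex.ofReal_mem_slitPlane]
    linarith [hr.1]
  · intro r hr
    have : Q.src s - Q.tgt s ≠ 0 := sub_ne_zero.2 hst
    push_cast
    field_simp
    ring

theorem view_rev {s : S} {u : ℂ} (h : u ∉ segment ℝ (Q.src s) (Q.tgt s)) :
    Q.view (Q.rev s) u = -Q.view s u := by
  have h1 := Complex.div_mem_slitPlane_of_notMem_segment h
  rw [← neg_sub u, ← neg_sub u (Q.src s), neg_div_neg_eq] at h1
  rw [view, view, ← Complex.arg_inv_of_mem_slitPlane h1, inv_div, tgt_rev, src_rev]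

theorem view_src (s : S) : Q.view s (Q.src s) = 0 := by simp [view]

theorem view_tgt (s : S) : Q.view s (Q.tgt s) = 0 := by simp [view]

theorem sight_sub_sight_of_src_eq_tgt {s t : S} (hne : t ≠ Q.rev s) (h : Q.src t = Q.tgt s) :
    Q.sight (Q.rev s) t - Q.sight s t = Q.view s (Q.tgt t) - Q.view s (Q.src t) := by
  have h1 := Q.sight_sub_sight_of_src_eq hne (by simpa using h)
  have hts : t ≠ s := by
    rintro rfl
    exact Q.src_ne t h
  have hnm : Q.tgt t ∉ segment ℝ (Q.src s) (Q.tgt s) := by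
    intro hmem
    rcases (Q.meet s t hts hne _ hmem (right_mem_segment ℝ _ _)).1 with h' | h'
    · exact hne (Q.eq_of_src_eq_of_tgt_eq (by simpa using h) (by simpa using h'))
    · exact Q.src_ne t (h.trans h'.symm)
  have h2 : Q.view (Q.rev s) (Q.tgt s) = 0 := by
    rw [← Q.src_rev, view_src]
  rw [Q.rev_rev, h, h2, Q.view_rev hnm] at h1
  rw [h, view_tgt]
  linarith

/-- Moving the observer along `s` changes the angle of sight of `t` by the turn of the direction to
its end minus that of the direction to its start. In the disjoint case the observer never meets `t`,
so the argument never crosses the cut; the shared-end cases reduce by reversal. -/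
theorem sight_sub_sight {s t : S} (hne : t ≠ s) (hrev : t ≠ Q.rev s) :
    Q.sight (Q.rev s) t - Q.sight s t = Q.view s (Q.tgt t) - Q.view s (Q.src t) := by
  have hne' : Q.rev t ≠ Q.rev s := fun h => hne (Q.rev_injective h)
  have hrev' : Q.rev t ≠ s := by
    rintro rfl
    exact hrev (Q.rev_rev t).symm
  by_cases h1 : Q.src t = Q.src s
  · exact Q.sight_sub_sight_of_src_eq hne h1
  by_cases h2 : Q.tgt t = Q.src s
  · have := Q.sight_sub_sight_of_src_eq hrev' h2
    rw [sight_rev, sight_rev, tgt_rev, src_rev] at this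
    linarith
  by_cases h3 : Q.src t = Q.tgt s
  · exact Q.sight_sub_sight_of_src_eq_tgt hrev h3
  by_cases h4 : Q.tgt t = Q.tgt s
  · have := Q.sight_sub_sight_of_src_eq_tgt hne' h4
    rw [sight_rev, sight_rev, tgt_rev, src_rev] at this
    linarith
  have hdisj : ∀ p ∈ segment ℝ (Q.src s) (Q.tgt s), p ∉ segment ℝ (Q.src t) (Q.tgt t) := by
    intro p hp hp'
    obtain ⟨h | h, h' | h'⟩ := Q.meet s t hne hrev p hp hp'
    · exact h1 (h'.symm.trans h)
    · exact h2 (h'.symm.trans h)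
    · exact h3 (h'.symm.trans h)
    · exact h4 (h'.symm.trans h)
  have n1 : Q.tgt t - Q.src s ≠ 0 := sub_ne_zero.2 h2
  have n2 : Q.src t - Q.src s ≠ 0 := sub_ne_zero.2 h1
  have hc : ∀ r ∈ Set.Icc (0 : ℝ) 1, Q.src t - (Q.src s + r * (Q.tgt s - Q.src s)) ≠ 0 := by
    intro r hr h0
    rw [sub_eq_zero] at h0
    exact hdisj _ (mem_segment_of_mem_Icc hr) (h0 ▸ left_mem_segment ℝ _ _)
  have ht1 : Q.tgt t ∉ segment ℝ (Q.src s) (Q.tgt s) := fun hm =>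
    hdisj _ hm (right_mem_segment ℝ _ _)
  have ht2 : Q.src t ∉ segment ℝ (Q.src s) (Q.tgt s) := fun hm =>
    hdisj _ hm (left_mem_segment ℝ _ _)
  have key := Complex.arg_eq_add_sub_of_path
    (f := fun r : ℝ => (Q.tgt t - (Q.src s + r * (Q.tgt s - Q.src s))) /
      (Q.src t - (Q.src s + r * (Q.tgt s - Q.src s))))
    (g := fun r : ℝ => (Q.tgt t - (Q.src s + r * (Q.tgt s - Q.src s))) / (Q.tgt t - Q.src s))
    (h := fun r : ℝ => (Q.src t - (Q.src s + r * (Q.tgt s - Q.src s))) / (Q.src t - Q.src s))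
    (ContinuousOn.div (by fun_prop) (by fun_prop) hc) (by fun_prop) (by fun_prop)
    (fun r hr => Complex.div_mem_slitPlane_of_notMem_segment
      (hdisj _ (mem_segment_of_mem_Icc hr)))
    (fun r hr => div_mem_slitPlane_of_moving ht1 hr)
    (fun r hr => div_mem_slitPlane_of_moving ht2 hr) ?_ (by simp [div_self n1])
    (by simp [div_self n2])
  · have e : ∀ u : ℂ, u - (Q.src s + (1 : ℝ) * (Q.tgt s - Q.src s)) = u - Q.tgt s := by
      intro u; push_cast; ring
    have e0 : ∀ u : ℂ, u - (Q.src s + (0 : ℝ) * (Q.tgt s - Q.src s)) = u - Q.src s := by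
      intro u; push_cast; ring
    simp only [e, e0] at key
    simp only [sight, src_rev, if_neg h1, if_neg h2, if_neg h3, if_neg h4, view, key]
    ring
  · intro r hr
    have h0 := hc r hr
    simp only [Complex.ofReal_zero, zero_mul, add_zero]
    field_simp

open Real

theorem sight_self (s : S) : Q.sight s s = π := by
  simp [sight, div_self (Q.vec_ne_zero s)]

/-- The counterclockwise angle, in `(0, 2π]`, from the segment `s` to the segment `t`. -/
noncomputable def turn (s t : S) : ℝ := (-(Q.vec t / Q.vec s)).arg + π

theorem turn_self (s : S) : Q.turn s s = 2 * π := by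
  simp [turn, div_self (Q.vec_ne_zero s)]
  ring

theorem turn_pos (s t : S) : 0 < Q.turn s t := by
  have := Complex.neg_pi_lt_arg (-(Q.vec t / Q.vec s))
  simp only [turn]; linarith

theorem turn_le (s t : S) : Q.turn s t ≤ 2 * π := by
  have := Complex.arg_le_pi (-(Q.vec t / Q.vec s))
  simp only [turn]; linarith

theorem coe_turn (s t : S) :
    (Q.turn s t : Real.Angle) = ((Q.vec t).arg : Real.Angle) - ((Q.vec s).arg : Real.Angle) := by
  have h1 := Q.vec_ne_zero s
  have h2 := Q.vec_ne_zero t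
  rw [turn, Real.Angle.coe_add, Complex.arg_neg_coe_angle (div_ne_zero h2 h1),
    Complex.arg_div_coe_angle h2 h1, add_assoc, Real.Angle.coe_pi_add_coe_pi, add_zero]

theorem turn_lt_two_pi {s t : S} (h : Q.src t = Q.src s) (hne : t ≠ s) :
    Q.turn s t < 2 * π := by
  have h1 := (Complex.mem_slitPlane_iff_arg.1 (Q.neg_vec_div_vec_mem_slitPlane h hne)).1
  have h2 := Complex.arg_le_pi (-(Q.vec t / Q.vec s))
  have := lt_of_le_of_ne h2 h1
  simp only [turn]; linarith

/-! ### Winding numbers of flows on segments -/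

section Circulation

variable [Fintype S] {z : S → ℝ}

/-- The winding number (up to a constant factor) of the flow `z` around a point just to the left
of the start of the segment `s`. -/
noncomputable def winding (z : S → ℝ) (s : S) : ℝ := ∑ t, z t * Q.sight s t

/-- The winding number to the left of a segment is the same at both ends. -/
theorem winding_rev (hz : ∀ s, z (Q.rev s) = -z s)
    (hdiv : ∀ p, ∑ t, (if Q.src t = p then z t else 0) = 0) (s : S) :
    Q.winding z s = Q.winding z (Q.rev s) + 4 * π * z s := by
  classical
  have hrs : Q.rev s ≠ s := fun h => Q.src_ne s (by rw [h])
  -- Grouped by starting point, the sum is a combination of divergences of `z`.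
  have hsum : ∑ t, z t * Q.view s (Q.src t) = 0 := by
    have : ∀ t, z t * Q.view s (Q.src t)
        = ∑ p ∈ Finset.univ.image Q.src, Q.view s p * (if Q.src t = p then z t else 0) := by
      intro t
      rw [Finset.sum_eq_single (Q.src t)]
      · simp [mul_comm]
      · intro p _ hp
        simp [hp.symm]
      · simp
    simp_rw [this]
    rw [Finset.sum_comm]
    simp_rw [← Finset.mul_sum, hdiv]
    simp
  have hsum' : ∑ t, z t * Q.view s (Q.tgt t) = 0 := by
    rw [← neg_eq_zero, ← hsum, ← Finset.sum_neg_distrib]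
    refine Finset.sum_nbij' Q.rev Q.rev (by simp) (by simp) (by simp [Q.rev_rev])
      (by simp [Q.rev_rev]) ?_
    intro t _
    rw [hz]
    simp
  -- Changing sides of `s` turns its own angle of sight from π to -π; `s` and its reversal
  -- contribute 2π times the flow each, whence the factor 4π.
  have hterm : ∀ t, z t * Q.sight s t - z t * Q.sight (Q.rev s) t
      = (z t * Q.view s (Q.src t) - z t * Q.view s (Q.tgt t))
        + ((if t = s then 2 * π * z s else 0) + (if t = Q.rev s then 2 * π * z s else 0)) := by
    intro t
    have e1 : Q.sight (Q.rev s) s = -π := by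
      have := Q.sight_rev (Q.rev s) (Q.rev s)
      rwa [Q.rev_rev, sight_self] at this
    by_cases h1 : t = s
    · subst h1
      simp [hrs.symm, view_src, view_tgt, sight_self, e1]
      ring
    by_cases h2 : t = Q.rev s
    · subst h2
      simp [hrs, view_src, view_tgt, sight_self, sight_rev, hz]
      ring
    · have := Q.sight_sub_sight h1 h2
      simp only [h1, h2, if_false]
      linear_combination (-z t) * this
  have : Q.winding z s - Q.winding z (Q.rev s) = 4 * π * z s := by
    simp only [winding]
    rw [← Finset.sum_sub_distrib, Finset.sum_congr rfl (fun t _ => hterm t),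
      Finset.sum_add_distrib, Finset.sum_sub_distrib, hsum, hsum', Finset.sum_add_distrib]
    simp
    ring
  linarith

/-- If `t` comes directly after `s` in the counterclockwise order around their common start, then
the left side of `s` is the right side of `t`. -/
theorem winding_of_next (hz : ∀ s, z (Q.rev s) = -z s)
    (hdiv : ∀ p, ∑ t, (if Q.src t = p then z t else 0) = 0) {s t : S} (h : Q.src t = Q.src s)
    (hmin : ∀ k, Q.src k = Q.src s → Q.turn s t ≤ Q.turn s k) :
    Q.winding z s = Q.winding z t - 4 * π * z t := by
  classical
  -- Turns add modulo 2π, and minimality of `t` excludes a wrap-around. Only `k = t` is special, as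
  -- `turn t t` is 2π and not 0.
  have hturn : ∀ k, Q.src k = Q.src s →
      Q.turn s k - Q.turn t k = Q.turn s t - (if k = t then 2 * π else 0) := by
    intro k hk
    by_cases hkt : k = t
    · subst hkt
      simp [turn_self]
    rw [if_neg hkt, sub_zero]
    have hang : ((Q.turn s k : ℝ) : Real.Angle) = ((Q.turn s t + Q.turn t k : ℝ) : Real.Angle) := by
      rw [Real.Angle.coe_add, coe_turn, coe_turn, coe_turn]
      abel
    rw [Real.Angle.angle_eq_iff_two_pi_dvd_sub] at hang
    obtain ⟨m, hm⟩ := hang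
    have b1 := hmin k hk
    have b2 := Q.turn_lt_two_pi (hk.trans h.symm) hkt
    have b3 := Q.turn_pos t k
    have b4 := Q.turn_le s k
    have b5 := Q.turn_pos s t
    have hpi := Real.pi_pos
    have m1 : (-1 : ℝ) < m := by nlinarith
    have m2 : (m : ℝ) < 1 := by nlinarith
    have m1' : -1 < m := by exact_mod_cast m1
    have m2' : m < 1 := by exact_mod_cast m2
    have : m = 0 := by omega
    rw [this] at hm
    simp at hm
    linarith
  have hterm : ∀ k, z k * Q.sight s k - z k * Q.sight t k
      = (if Q.src k = Q.src s then z k * (Q.turn s k - Q.turn t k) else 0)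
        + (if Q.src (Q.rev k) = Q.src s then
            z (Q.rev k) * (Q.turn s (Q.rev k) - Q.turn t (Q.rev k)) else 0) := by
    intro k
    by_cases h1 : Q.src k = Q.src s
    · have h2 : Q.tgt k ≠ Q.src s := by rw [← h1]; exact (Q.src_ne k).symm
      have h3 : Q.src (Q.rev k) ≠ Q.src s := h2
      rw [if_pos h1, if_neg h3]
      simp only [sight, h, if_pos h1, turn]
      ring
    by_cases h2 : Q.tgt k = Q.src s
    · simp only [sight, h, if_neg h1, src_rev, if_pos h2, turn, hz]
      ring
    · have h3 : Q.src (Q.rev k) ≠ Q.src s := h2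
      rw [if_neg h1, if_neg h3]
      simp only [sight, h, if_neg h1, if_neg h2]
      ring
  -- The constant `turn s t` is multiplied by the divergence at the common start and disappears;
  -- only the correction at `k = t` survives.
  have hhalf : ∑ k, (if Q.src k = Q.src s then z k * (Q.turn s k - Q.turn t k) else 0)
      = -(2 * π * z t) := by
    have : ∀ k, (if Q.src k = Q.src s then z k * (Q.turn s k - Q.turn t k) else 0)
        = Q.turn s t * (if Q.src k = Q.src s then z k else 0)
          - (if k = t then 2 * π * z t else 0) := by
      intro k
      by_cases h1 : Q.src k = Q.src s
      · rw [if_pos h1, if_pos h1, hturn k h1]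
        by_cases hkt : k = t
        · subst hkt; simp; ring
        · simp [hkt]; ring
      · have hkt : k ≠ t := by rintro rfl; exact h1 h
        simp [h1, hkt]
    rw [Finset.sum_congr rfl (fun k _ => this k), Finset.sum_sub_distrib, ← Finset.mul_sum, hdiv]
    simp
  have hhalf' : ∑ k, (if Q.src (Q.rev k) = Q.src s then
      z (Q.rev k) * (Q.turn s (Q.rev k) - Q.turn t (Q.rev k)) else 0) = -(2 * π * z t) := by
    rw [← hhalf]
    exact Finset.sum_nbij' Q.rev Q.rev (by simp) (by simp) (by simp [Q.rev_rev])
      (by simp [Q.rev_rev]) (by simp)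
  have : Q.winding z s - Q.winding z t = -(4 * π * z t) := by
    simp only [winding]
    rw [← Finset.sum_sub_distrib, Finset.sum_congr rfl (fun k _ => hterm k),
      Finset.sum_add_distrib, hhalf, hhalf']
    ring
  linarith

end Circulation

end SegmentSystem

/-! ### Simple broken lines -/

theorem segment_subset_brokenLine {l : List ℂ} {i : ℕ} (hi : i + 1 < l.length) :
    segment ℝ (l.getD i 0) (l.getD (i + 1) 0) ⊆ brokenLine l := by
  induction l generalizing i with
  | nil => simp at hi
  | cons a l ih =>
    cases l with
    | nil => simp at hi
    | cons b l =>
      cases i with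
      | zero => exact Set.subset_union_left
      | succ i => exact (ih (i := i) (by simpa using hi)).trans Set.subset_union_right

theorem mem_brokenLine_of_mem {l : List ℂ} {p : ℂ} (hp : p ∈ l) : p ∈ brokenLine l := by
  induction l with
  | nil => simp at hp
  | cons a l ih =>
    cases l with
    | nil => simpa [brokenLine] using hp
    | cons b l =>
      rcases List.mem_cons.1 hp with rfl | h
      · exact Or.inl (left_mem_segment ℝ _ _)
      · exact Or.inr (ih h)

theorem IsSimpleBrokenLine.nodup {l : List ℂ} (h : IsSimpleBrokenLine l) : l.Nodup := by
  induction l with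
  | nil => simp
  | cons a l ih =>
    cases l with
    | nil => simp
    | cons b l =>
      obtain ⟨hab, hinter, hs⟩ := h
      refine List.nodup_cons.2 ⟨fun ha => hab ?_, ih hs⟩
      have : a ∈ segment ℝ a b ∩ brokenLine (b :: l) :=
        ⟨left_mem_segment ℝ _ _, mem_brokenLine_of_mem ha⟩
      rw [hinter] at this
      exact this

/-- The first segment meets the rest only in its end `b`. By induction the segment starting at `b`
meets later ones only in its own end, which is not `b`. -/
theorem IsSimpleBrokenLine.meet {l : List ℂ} (h : IsSimpleBrokenLine l) {i j : ℕ} (hij : i < j)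
    (hj : j + 1 < l.length) {p : ℂ} (hp : p ∈ segment ℝ (l.getD i 0) (l.getD (i + 1) 0))
    (hp' : p ∈ segment ℝ (l.getD j 0) (l.getD (j + 1) 0)) :
    p = l.getD (i + 1) 0 ∧ j = i + 1 := by
  induction l generalizing i j with
  | nil => simp at hj
  | cons a l ih =>
    cases l with
    | nil => simp at hj
    | cons b l =>
      obtain ⟨hab, hinter, hs⟩ := h
      obtain ⟨j, rfl⟩ : ∃ j', j = j' + 1 := ⟨j - 1, by omega⟩
      simp only [List.getD_cons_succ] at hp'
      have hj' : j + 1 < (b :: l).length := by simpa using hj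
      cases i with
      | zero =>
        have hpb : p = b := by
          have : p ∈ segment ℝ a b ∩ brokenLine (b :: l) :=
            ⟨by simpa using hp, segment_subset_brokenLine hj' hp'⟩
          rw [hinter] at this
          exact this
        refine ⟨by simpa using hpb, ?_⟩
        by_contra hj0
        have hj0 : 0 < j := by omega
        have h1 := (ih hs hj0 hj' (by simpa [hpb] using left_mem_segment ℝ b _) hp').1
        have hnd := hs.nodup
        rw [hpb] at h1
        have hl : 0 < l.length := by simp at hj'; omega
        cases l with
        | nil => simp at hl
        | cons c l =>
          simp at h1
          exact hs.1 h1
      | succ i =>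
        simp only [List.getD_cons_succ] at hp ⊢
        have := ih hs (by omega : i < j) hj' hp hp'
        exact ⟨this.1, by omega⟩

theorem List.Nodup.getD_inj {l : List ℂ} (h : l.Nodup) {i j : ℕ} (hi : i < l.length)
    (hj : j < l.length) (he : l.getD i 0 = l.getD j 0) : i = j := by
  rw [List.getD_eq_getElem _ _ hi, List.getD_eq_getElem _ _ hj] at he
  exact (h.getElem_inj_iff).1 he

theorem List.getD_reverse_of_add {l : List ℂ} {i j : ℕ} (h : i + j + 1 = l.length) :
    l.reverse.getD i 0 = l.getD j 0 := by
  rw [List.getD_eq_getElem _ _ (by simp; omega), List.getD_eq_getElem _ _ (by omega),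
    List.getElem_reverse]
  congr 1
  omega

/-! ### The straight pieces of a plane drawing -/

namespace PlaneDrawing

variable {V : Type*} {G : SimpleGraph V} (D : PlaneDrawing G)

/-- All corners of the arc of a dart, including its ends. -/
def corners (d : G.Dart) : List ℂ := D.pos d.fst :: (D.bend d ++ [D.pos d.snd])

theorem corners_symm (d : G.Dart) : D.corners d.symm = (D.corners d).reverse := by
  simp [corners, D.bend_symm]

theorem length_corners (d : G.Dart) : (D.corners d).length = (D.bend d).length + 2 := by
  simp [corners]

theorem length_bend_symm (d : G.Dart) : (D.bend d.symm).length = (D.bend d).length := by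
  simp [D.bend_symm]

/-- The corner number `i` of the arc of a dart. -/
def corner (d : G.Dart) (i : ℕ) : ℂ := (D.corners d).getD i 0

theorem corner_zero (d : G.Dart) : D.corner d 0 = D.pos d.fst := rfl

theorem corner_symm {d : G.Dart} {i j : ℕ} (h : i + j = (D.bend d).length + 1) :
    D.corner d.symm i = D.corner d j := by
  rw [corner, corners_symm, List.getD_reverse_of_add (j := j) (by rw [length_corners]; omega),
    corner]

theorem corner_eq_of_eq_symm {d e : G.Dart} (he : e = d.symm) {i j : ℕ}
    (h : i + j = (D.bend d).length + 1) : D.corner e i = D.corner d j := by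
  subst he
  exact D.corner_symm h

theorem corner_last (d : G.Dart) : D.corner d ((D.bend d).length + 1) = D.pos d.snd := by
  rw [← D.corner_symm (i := 0) (by omega), corner_zero]
  rfl

theorem corner_one (d : G.Dart) : D.corner d 1 = (D.bend d).headD (D.pos d.snd) := by
  rw [corner, corners]
  cases D.bend d <;> simp

theorem corner_inj {d : G.Dart} {i j : ℕ} (hi : i ≤ (D.bend d).length + 1)
    (hj : j ≤ (D.bend d).length + 1) (h : D.corner d i = D.corner d j) : i = j :=
  (D.isSimple d).nodup.getD_inj (by rw [← corners, length_corners]; omega)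
    (by rw [← corners, length_corners]; omega) h

theorem segment_corner_subset {d : G.Dart} {i : ℕ} (hi : i ≤ (D.bend d).length) :
    segment ℝ (D.corner d i) (D.corner d (i + 1)) ⊆ brokenLine (D.corners d) :=
  segment_subset_brokenLine (by rw [length_corners]; omega)

theorem corner_mem_brokenLine {d : G.Dart} {i : ℕ} (hi : i ≤ (D.bend d).length + 1) :
    D.corner d i ∈ brokenLine (D.corners d) := by
  refine mem_brokenLine_of_mem ?_
  rw [corner, List.getD_eq_getElem _ _ (by rw [length_corners]; omega)]
  exact List.getElem_mem _

theorem segment_corner_meet {d : G.Dart} {i j : ℕ} (hij : i < j) (hj : j ≤ (D.bend d).length)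
    {p : ℂ} (hp : p ∈ segment ℝ (D.corner d i) (D.corner d (i + 1)))
    (hp' : p ∈ segment ℝ (D.corner d j) (D.corner d (j + 1))) :
    p = D.corner d (i + 1) ∧ j = i + 1 :=
  (D.isSimple d).meet hij (by rw [← corners, length_corners]; omega) hp hp'

theorem eq_zero_of_fst_mem {d : G.Dart} {i : ℕ} (hi : i ≤ (D.bend d).length)
    (h : D.pos d.fst ∈ segment ℝ (D.corner d i) (D.corner d (i + 1))) : i = 0 := by
  by_contra h0
  have := (D.segment_corner_meet (Nat.pos_of_ne_zero h0) hi
    (by rw [corner_zero]; exact left_mem_segment ℝ _ _) h).1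
  rw [← corner_zero] at this
  have := D.corner_inj (by omega) (by omega) this
  omega

theorem eq_length_of_snd_mem {d : G.Dart} {i : ℕ} (hi : i ≤ (D.bend d).length)
    (h : D.pos d.snd ∈ segment ℝ (D.corner d i) (D.corner d (i + 1))) :
    i = (D.bend d).length := by
  by_contra h0
  have := (D.segment_corner_meet (lt_of_le_of_ne hi h0) le_rfl h
    (by rw [corner_last]; exact right_mem_segment ℝ _ _))
  rw [← corner_last] at this
  have := D.corner_inj (by omega) (by omega) this.1
  omega

theorem eq_corner_of_mem_ends {d : G.Dart} {i : ℕ} (hi : i ≤ (D.bend d).length) {p : ℂ}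
    (hp : p ∈ segment ℝ (D.corner d i) (D.corner d (i + 1)))
    (h : p ∈ ({D.pos d.fst, D.pos d.snd} : Set ℂ)) :
    p = D.corner d i ∨ p = D.corner d (i + 1) := by
  rcases h with rfl | h
  · rw [D.eq_zero_of_fst_mem hi hp]
    exact Or.inl rfl
  · rw [Set.mem_singleton_iff] at h
    subst h
    rw [D.eq_length_of_snd_mem hi hp, corner_last]
    exact Or.inr rfl

/-- The index type of the oriented straight pieces of all arcs. -/
abbrev Piece : Type _ := Σ d : G.Dart, Fin ((D.bend d).length + 1)

theorem piece_ext {s t : D.Piece} (h1 : s.1 = t.1) (h2 : (s.2 : ℕ) = t.2) : s = t := by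
  obtain ⟨d, i⟩ := s
  obtain ⟨d', j⟩ := t
  dsimp only at h1
  subst h1
  exact Sigma.ext rfl (heq_of_eq (Fin.ext h2))

/-- The piece with the opposite orientation. -/
def pieceRev (s : D.Piece) : D.Piece :=
  ⟨s.1.symm, (D.bend s.1).length - s.2, by rw [length_bend_symm]; omega⟩

theorem pieceRev_fst (s : D.Piece) : (D.pieceRev s).1 = s.1.symm := rfl

theorem pieceRev_snd (s : D.Piece) :
    ((D.pieceRev s).2 : ℕ) = (D.bend s.1).length - s.2 := rfl

theorem pieceRev_pieceRev (s : D.Piece) : D.pieceRev (D.pieceRev s) = s := by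
  have := s.2.2
  refine D.piece_ext (by simp [pieceRev_fst]) ?_
  change (D.bend s.1.symm).length - ((D.bend s.1).length - s.2) = s.2
  rw [length_bend_symm]
  omega

theorem corner_pieceRev (s : D.Piece) :
    D.corner (D.pieceRev s).1 (D.pieceRev s).2 = D.corner s.1 (s.2 + 1) := by
  have := s.2.2
  exact D.corner_symm (by rw [pieceRev_snd]; omega)

theorem corner_pieceRev_succ (s : D.Piece) :
    D.corner (D.pieceRev s).1 ((D.pieceRev s).2 + 1) = D.corner s.1 s.2 := by
  have := s.2.2
  exact D.corner_symm (by rw [pieceRev_snd]; omega)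

theorem piece_meet_of_eq {s t : D.Piece} (hd : t.1 = s.1) (hts : t ≠ s) {p : ℂ}
    (hp : p ∈ segment ℝ (D.corner s.1 s.2) (D.corner s.1 (s.2 + 1)))
    (hp' : p ∈ segment ℝ (D.corner t.1 t.2) (D.corner t.1 (t.2 + 1))) :
    (p = D.corner s.1 s.2 ∨ p = D.corner s.1 (s.2 + 1)) ∧
      (p = D.corner t.1 t.2 ∨ p = D.corner t.1 (t.2 + 1)) := by
  obtain ⟨d, i⟩ := s
  obtain ⟨d', j⟩ := t
  dsimp only at hd hp hp' ⊢
  subst hd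
  have hne : (i : ℕ) ≠ j := fun h => hts (D.piece_ext rfl h.symm)
  rcases lt_or_gt_of_ne hne with h | h
  · have := D.segment_corner_meet h (by omega) hp hp'
    exact ⟨Or.inr this.1, Or.inl (by rw [this.2]; exact this.1)⟩
  · have := D.segment_corner_meet h (by omega) hp' hp
    exact ⟨Or.inl (by rw [this.2]; exact this.1), Or.inr this.1⟩

/-- The oriented straight pieces of the arcs of a plane drawing. -/
def pieces : SegmentSystem D.Piece where
  src s := D.corner s.1 s.2
  rev := D.pieceRev
  rev_rev := D.pieceRev_pieceRev
  src_ne s h := by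
    have := s.2.2
    rw [corner_pieceRev] at h
    have := D.corner_inj (by omega) (by omega) h
    omega
  meet s t hts htr p hp hp' := by
    rw [corner_pieceRev] at hp hp' ⊢
    rw [corner_pieceRev]
    have hs2 := s.2.2
    have ht2 := t.2.2
    by_cases he : s.1.edge = t.1.edge
    · rcases (SimpleGraph.dart_edge_eq_iff _ _).1 he with h | h
      · exact D.piece_meet_of_eq h.symm hts hp hp'
      · have h1 : (D.pieceRev t).1 = s.1 := by rw [pieceRev_fst, h]
        have h2 : D.pieceRev t ≠ s := by
          rintro rfl
          exact htr (D.pieceRev_pieceRev t).symm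
        have := D.piece_meet_of_eq h1 h2 hp
          (by rw [corner_pieceRev, corner_pieceRev_succ, segment_symm]; exact hp')
        rw [corner_pieceRev, corner_pieceRev_succ] at this
        exact ⟨this.1, this.2.symm⟩
    · have := D.inter_subset s.1 t.1 he
        ⟨D.segment_corner_subset (by omega) hp, D.segment_corner_subset (by omega) hp'⟩
      exact ⟨D.eq_corner_of_mem_ends (by omega) hp this.1,
        D.eq_corner_of_mem_ends (by omega) hp' this.2⟩

theorem pieces_src (s : D.Piece) : D.pieces.src s = D.corner s.1 s.2 := rfl

theorem pieces_rev (s : D.Piece) : D.pieces.rev s = D.pieceRev s := rfl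

theorem pieces_tgt (s : D.Piece) : D.pieces.tgt s = D.corner s.1 (s.2 + 1) :=
  D.corner_pieceRev s

/-- The first piece of the arc of a dart. -/
def firstPiece (d : G.Dart) : D.Piece := ⟨d, 0, Nat.succ_pos _⟩

theorem pieces_src_firstPiece (d : G.Dart) : D.pieces.src (D.firstPiece d) = D.pos d.fst := rfl

theorem coe_arg_vec_firstPiece (d : G.Dart) :
    ((D.pieces.vec (D.firstPiece d)).arg : Real.Angle) = D.angle d := by
  rw [SegmentSystem.vec, pieces_tgt, pieces_src_firstPiece, angle]
  simp only [firstPiece, zero_add, corner_one]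

theorem eq_firstPiece_of_src {k : D.Piece} {v : V} (h : D.pieces.src k = D.pos v) :
    k.1.fst = v ∧ k = D.firstPiece k.1 := by
  have hk2 := k.2.2
  rw [pieces_src] at h
  have hmem : D.pos v ∈ brokenLine (D.corners k.1) := by
    rw [← h]
    exact D.corner_mem_brokenLine (by omega)
  rcases D.eq_of_pos_mem k.1 v hmem with hv | hv
  · rw [hv, ← corner_zero] at h
    have := D.corner_inj (by omega) (by omega) h
    exact ⟨hv.symm, D.piece_ext rfl this⟩
  · rw [hv, ← corner_last] at h
    have := D.corner_inj (by omega) (by omega) h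
    omega

/-- At a bend only the outgoing piece and the reversed incoming piece start, since arcs of different
edges share at most their ends. -/
theorem eq_or_eq_of_src_inner {d : G.Dart} {i : ℕ} (hi0 : 0 < i) (hi : i ≤ (D.bend d).length)
    {k : D.Piece} (h : D.pieces.src k = D.corner d i) :
    k = ⟨d, i, by omega⟩ ∨ k = D.pieceRev ⟨d, i - 1, by omega⟩ := by
  have hk2 := k.2.2
  rw [pieces_src] at h
  by_cases he : d.edge = k.1.edge
  · rcases (SimpleGraph.dart_edge_eq_iff _ _).1 he with hd | hd
    · left
      subst hd
      have := D.corner_inj (by omega) (by omega) h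
      exact D.piece_ext rfl this
    · right
      have hd' : k.1 = d.symm := by rw [hd, SimpleGraph.Dart.symm_symm]
      have hl : (D.bend k.1).length = (D.bend d).length := by rw [hd', length_bend_symm]
      have hc : D.corner k.1 k.2 = D.corner d ((D.bend d).length + 1 - k.2) := by
        exact D.corner_eq_of_eq_symm hd' (by omega)
      rw [hc] at h
      have := D.corner_inj (by omega) (by omega) h
      refine D.piece_ext hd' ?_
      rw [pieceRev_snd]
      dsimp only
      omega
  · exfalso
    have := (D.inter_subset d k.1 he ⟨D.corner_mem_brokenLine (i := i) (by omega),
      h ▸ D.corner_mem_brokenLine (by omega)⟩).1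
    rcases this with h' | h'
    · rw [← corner_zero] at h'
      have := D.corner_inj (by omega) (by omega) h'
      omega
    · rw [Set.mem_singleton_iff, ← corner_last] at h'
      have := D.corner_inj (by omega) (by omega) h'
      omega

/-! ### Winding numbers of flows on darts -/

section Circulation

open Real

variable [Fintype V] [DecidableRel G.Adj] [DecidableEq V]

theorem sum_pieces_src_eq_zero {z : G.Dart → ℝ} (hz : ∀ d, z d.symm = -z d)
    (hdiv : ∀ v, ∑ d, (if d.fst = v then z d else 0) = 0) (p : ℂ) :
    ∑ s : D.Piece, (if D.pieces.src s = p then z s.1 else 0) = 0 := by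
  classical
  have hsplit : ∀ s : D.Piece, (if D.pieces.src s = p then z s.1 else 0)
      = (if s = D.firstPiece s.1 then (if D.pieces.src s = p then z s.1 else 0) else 0)
        + (if s ≠ D.firstPiece s.1 then (if D.pieces.src s = p then z s.1 else 0) else 0) := by
    intro s
    by_cases h : s = D.firstPiece s.1
    · rw [if_pos h, if_neg (not_not.2 h), add_zero]
    · rw [if_neg h, if_pos h, zero_add]
  rw [Finset.sum_congr rfl (fun s _ => hsplit s), Finset.sum_add_distrib]
  have h1 : ∑ s : D.Piece,
      (if s = D.firstPiece s.1 then (if D.pieces.src s = p then z s.1 else 0) else 0) = 0 := by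
    rw [Fintype.sum_sigma]
    have : ∀ d : G.Dart, ∑ i : Fin ((D.bend d).length + 1),
        (if (⟨d, i⟩ : D.Piece) = D.firstPiece d then
          (if D.pieces.src ⟨d, i⟩ = p then z d else 0) else 0)
        = if D.pos d.fst = p then z d else 0 := by
      intro d
      rw [Finset.sum_eq_single 0]
      · rw [if_pos (by rfl), pieces_src]
        rfl
      · intro i _ hi
        rw [if_neg]
        intro h
        apply hi
        have := congrArg (fun s : D.Piece => (s.2 : ℕ)) h
        exact Fin.ext this
      · simp
    rw [Finset.sum_congr rfl (fun d _ => this d)]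
    by_cases hp : ∃ v, D.pos v = p
    · obtain ⟨v, rfl⟩ := hp
      simp only [D.pos_injective.eq_iff]
      exact hdiv v
    · push Not at hp
      simp [hp]
  have h2 : ∑ s : D.Piece,
      (if s ≠ D.firstPiece s.1 then (if D.pieces.src s = p then z s.1 else 0) else 0) = 0 := by
    rw [← Finset.sum_filter]
    have hpos : ∀ s : D.Piece, s ≠ D.firstPiece s.1 → 0 < (s.2 : ℕ) := by
      intro s hs
      rcases Nat.eq_zero_or_pos (s.2 : ℕ) with h | h
      · exact absurd (D.piece_ext (s := s) (t := D.firstPiece s.1) rfl h) hs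
      · exact h
    -- The other piece that starts at the same bend belongs to the reversed dart and carries the
    -- opposite flow; this pairing cancels all inner corners.
    let g : D.Piece → D.Piece := fun s =>
      if h : 0 < (s.2 : ℕ) then
        ⟨s.1.symm, (D.bend s.1).length + 1 - s.2, by rw [length_bend_symm]; omega⟩
      else s
    have hg : ∀ s : D.Piece, s ≠ D.firstPiece s.1 →
        (g s).1 = s.1.symm ∧ ((g s).2 : ℕ) = (D.bend s.1).length + 1 - s.2 := by
      intro s hs
      have hgs : g s = _ := dif_pos (hpos s hs)
      rw [hgs]
      exact ⟨rfl, rfl⟩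
    have hg' : ∀ s : D.Piece, s ≠ D.firstPiece s.1 → g s ≠ D.firstPiece (g s).1 := by
      intro s hs h
      have h3 := congrArg (fun s : D.Piece => (s.2 : ℕ)) h
      have h4 := (hg s hs).2
      have h5 := s.2.2
      have h6 : ((D.firstPiece (g s).1).2 : ℕ) = 0 := rfl
      omega
    refine Finset.sum_involution (fun s _ => g s) ?_ ?_ ?_ ?_
    · intro s hs
      have hs := (Finset.mem_filter.1 hs).2
      obtain ⟨h3, h4⟩ := hg s hs
      have h5 := s.2.2
      have : D.pieces.src (g s) = D.pieces.src s := by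
        exact D.corner_eq_of_eq_symm h3 (by omega)
      rw [this, h3, hz]
      split_ifs <;> simp
    · intro s hs _ h
      have hs := (Finset.mem_filter.1 hs).2
      have := (hg s hs).1
      rw [h] at this
      exact s.1.symm_ne this.symm
    · intro s hs
      have hs := (Finset.mem_filter.1 hs).2
      exact Finset.mem_filter.2 ⟨Finset.mem_univ _, hg' s hs⟩
    · intro s hs
      have hs := (Finset.mem_filter.1 hs).2
      obtain ⟨h3, h4⟩ := hg s hs
      obtain ⟨h5, h6⟩ := hg _ (hg' s hs)
      have h7 := s.2.2
      refine D.piece_ext (by rw [h5, h3, SimpleGraph.Dart.symm_symm]) ?_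
      have h8 : (D.bend (g s).1).length = (D.bend s.1).length := by rw [h3, length_bend_symm]
      omega
  rw [h1, h2, add_zero]

/-- The winding number (up to a constant factor) of a flow `z` on the darts around a point just
to the left of a dart. -/
noncomputable def flowWinding (z : G.Dart → ℝ) (d : G.Dart) : ℝ :=
  D.pieces.winding (fun s => z s.1) (D.firstPiece d)

/-- The left-hand winding number is carried unchanged along the arc to its last piece; crossing
there to the other side gives the jump. -/
theorem flowWinding_symm {z : G.Dart → ℝ} (hz : ∀ d, z d.symm = -z d)
    (hdiv : ∀ v, ∑ d, (if d.fst = v then z d else 0) = 0) (d : G.Dart) :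
    D.flowWinding z d = D.flowWinding z d.symm + 4 * π * z d := by
  have hz' : ∀ s : D.Piece, (fun s : D.Piece => z s.1) (D.pieces.rev s)
      = -(fun s : D.Piece => z s.1) s := fun s => hz s.1
  have hdiv' := D.sum_pieces_src_eq_zero hz hdiv
  have hstep : ∀ i (hi : i < (D.bend d).length + 1),
      D.pieces.winding (fun s => z s.1) ⟨d, i, hi⟩ = D.flowWinding z d := by
    intro i
    induction i with
    | zero => intro _; rfl
    | succ i ih =>
      intro hi
      have hi' : i + 1 ≤ (D.bend d).length := by omega
      rw [← ih (by omega)]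
      have h1 := D.pieces.winding_rev hz' hdiv' ⟨d, i, by omega⟩
      have hsrc : D.pieces.src (D.pieces.rev ⟨d, i, by omega⟩) = D.corner d (i + 1) :=
        D.pieces_tgt ⟨d, i, by omega⟩
      -- With only two pieces at a bend, the reversed incoming piece directly follows the outgoing
      -- one, so both have the same left side.
      have h2 := D.pieces.winding_of_next hz' hdiv' (s := ⟨d, i + 1, hi⟩)
        (t := D.pieces.rev ⟨d, i, by omega⟩) hsrc ?_
      · rw [h1, h2]
        simp only [pieces_rev, pieceRev_fst, hz]
        ring
      · intro k hk
        rcases D.eq_or_eq_of_src_inner (Nat.succ_pos i) hi' hk with rfl | rfl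
        · rw [SegmentSystem.turn_self]
          exact D.pieces.turn_le _ _
        · exact le_rfl
  have h1 := D.pieces.winding_rev hz' hdiv' ⟨d, (D.bend d).length, by omega⟩
  rw [hstep] at h1
  rw [h1, flowWinding]
  have : D.pieces.rev ⟨d, (D.bend d).length, by omega⟩ = D.firstPiece d.symm :=
    D.piece_ext rfl (by rw [pieces_rev, pieceRev_snd]; simp [firstPiece])
  rw [this]

/-- The counterclockwise angle, in `(0, 2π]`, from one dart to another. -/
noncomputable def gap (d e : G.Dart) : ℝ := D.pieces.turn (D.firstPiece d) (D.firstPiece e)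

theorem flowWinding_of_next {z : G.Dart → ℝ} (hz : ∀ d, z d.symm = -z d)
    (hdiv : ∀ v, ∑ d, (if d.fst = v then z d else 0) = 0) {d e : G.Dart} (h : e.fst = d.fst)
    (hmin : ∀ k : G.Dart, k.fst = d.fst → D.gap d e ≤ D.gap d k) :
    D.flowWinding z d = D.flowWinding z e - 4 * π * z e := by
  refine D.pieces.winding_of_next (s := D.firstPiece d) (t := D.firstPiece e)
    (fun s => hz s.1) (D.sum_pieces_src_eq_zero hz hdiv)
    (by rw [pieces_src_firstPiece, pieces_src_firstPiece, h]) ?_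
  intro k hk
  rw [pieces_src_firstPiece] at hk
  obtain ⟨h1, h2⟩ := D.eq_firstPiece_of_src hk
  rw [h2]
  exact hmin _ h1

end Circulation

/-! ### Angles between darts -/

theorem gap_self (d : G.Dart) : D.gap d d = 2 * Real.pi := D.pieces.turn_self _

theorem gap_pos (d e : G.Dart) : 0 < D.gap d e := D.pieces.turn_pos _ _

theorem gap_le (d e : G.Dart) : D.gap d e ≤ 2 * Real.pi := D.pieces.turn_le _ _

theorem gap_lt {d e : G.Dart} (h : e.fst = d.fst) (hne : e ≠ d) : D.gap d e < 2 * Real.pi :=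
  D.pieces.turn_lt_two_pi (by rw [pieces_src_firstPiece, pieces_src_firstPiece, h])
    (fun h => hne (congrArg Sigma.fst h))

theorem coe_gap (d e : G.Dart) : (D.gap d e : Real.Angle) = D.angle e - D.angle d := by
  rw [gap, SegmentSystem.coe_turn, coe_arg_vec_firstPiece, coe_arg_vec_firstPiece]

end PlaneDrawing

namespace Real.Angle

theorem eq_of_coe_eq_of_abs_sub_lt {x y : ℝ} (h : (x : Real.Angle) = y)
    (h' : |x - y| < 2 * π) : x = y := by
  rw [Real.Angle.angle_eq_iff_two_pi_dvd_sub] at h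
  obtain ⟨m, hm⟩ := h
  have hpi := Real.pi_pos
  obtain ⟨h1, h2⟩ := abs_lt.1 h'
  have m1 : (-1 : ℝ) < m := by nlinarith
  have m2 : (m : ℝ) < 1 := by nlinarith
  have m1' : -1 < m := by exact_mod_cast m1
  have m2' : m < 1 := by exact_mod_cast m2
  have : m = 0 := by omega
  rw [this] at hm
  simp at hm
  linarith

theorem sbtw_coe {x y z : ℝ} (hxy : x < y) (hyz : y < z) (hzx : z < x + 2 * π) :
    sbtw (x : Real.Angle) (y : Real.Angle) (z : Real.Angle) := by
  have : Fact (0 < 2 * π) := ⟨by positivity⟩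
  rw [sbtw_iff_not_btw]
  intro h
  have h2 : btw (x : Real.Angle) (z : Real.Angle) (y : Real.Angle) :=
    btw_cyclic_left (btw_cyclic_left h)
  have h3 := (QuotientAddGroup.btw_coe_iff (p := 2 * π)).1 h2
  rw [(toIcoMod_eq_self _).2 ⟨by linarith, by linarith⟩,
    (toIocMod_eq_self _).2 ⟨by linarith, by linarith⟩] at h3
  linarith

end Real.Angle

namespace PlaneDrawing

open Real

variable {V : Type*} {G : SimpleGraph V} (D : PlaneDrawing G)

/-- Both sides agree modulo 2π and lie in (0, 2π]. -/
theorem gap_add {d e k : G.Dart} (h : D.gap d e + D.gap e k ≤ 2 * π) :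
    D.gap d e + D.gap e k = D.gap d k := by
  refine Real.Angle.eq_of_coe_eq_of_abs_sub_lt ?_ ?_
  · rw [Real.Angle.coe_add, coe_gap, coe_gap, coe_gap]
    abel
  · have := D.gap_pos d e
    have := D.gap_pos e k
    have := D.gap_pos d k
    have := D.gap_le d k
    rw [abs_lt]
    constructor <;> linarith

theorem gap_sub {d e k : G.Dart} (h : D.gap d e < D.gap d k) :
    D.gap e k = D.gap d k - D.gap d e := by
  refine Real.Angle.eq_of_coe_eq_of_abs_sub_lt ?_ ?_
  · rw [Real.Angle.coe_sub, coe_gap, coe_gap, coe_gap]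
    abel
  · have := D.gap_pos d e
    have := D.gap_pos e k
    have := D.gap_le d k
    have := D.gap_le e k
    rw [abs_lt]
    constructor <;> linarith

theorem eq_of_gap_eq {d e k : G.Dart} (hek : k.fst = e.fst) (h : D.gap d e = D.gap d k) :
    e = k := by
  by_contra hne
  have h1 := D.gap_lt hek (Ne.symm hne)
  have h2 := D.gap_pos e k
  have h3 : D.gap e k = 0 := by
    refine Real.Angle.eq_of_coe_eq_of_abs_sub_lt ?_ (by rw [abs_lt]; constructor <;> linarith)
    have := D.coe_gap d e
    rw [h, coe_gap] at this
    rw [coe_gap, sub_left_injective this]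
    simp
  linarith

theorem gap_add_gap {d e : G.Dart} (hed : e.fst = d.fst) (hne : e ≠ d) :
    D.gap d e + D.gap e d = 2 * π := by
  have h1 := D.gap_lt hed hne
  rw [← D.gap_self d] at h1
  have := D.gap_sub h1
  rw [gap_self] at this
  linarith

/-! ### The rotation system and stars -/

section Next

variable [Fintype V] [DecidableRel G.Adj]

theorem exists_next (d : G.Dart) :
    ∃ e : G.Dart, e.fst = d.fst ∧ ∀ k : G.Dart, k.fst = d.fst → D.gap d e ≤ D.gap d k := by
  classical
  obtain ⟨e, he, hmin⟩ := (Finset.univ.filter fun k : G.Dart => k.fst = d.fst).exists_min_image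
    (D.gap d) ⟨d, by simp⟩
  simp only [Finset.mem_filter, Finset.mem_univ, true_and] at he hmin
  exact ⟨e, he, hmin⟩

/-- The dart that follows `d` counterclockwise around `d.fst`. -/
noncomputable def nextFun (d : G.Dart) : G.Dart := (D.exists_next d).choose

theorem nextFun_fst (d : G.Dart) : (D.nextFun d).fst = d.fst := (D.exists_next d).choose_spec.1

theorem gap_nextFun_le {d k : G.Dart} (h : k.fst = d.fst) : D.gap d (D.nextFun d) ≤ D.gap d k :=
  (D.exists_next d).choose_spec.2 k h

/-- Let `k ≠ l` have the same successor. If it is not `l`, then turning from `l` one meets `k`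
strictly before it; if it is `l`, its gap from `l` is 2π, beyond `k`. Either way it is not the first
dart after `l`. -/
theorem nextFun_injective : Function.Injective D.nextFun := by
  intro k l h
  by_contra hne
  have hkl : l.fst = k.fst := by rw [← D.nextFun_fst k, h, D.nextFun_fst]
  have e1 := D.gap_add_gap hkl (Ne.symm hne)
  have hml : (D.nextFun k).fst = l.fst := by rw [D.nextFun_fst, hkl]
  have b1 := D.gap_nextFun_le hkl
  have b2 : D.gap l (D.nextFun k) ≤ D.gap l k := by
    rw [h]; exact D.gap_nextFun_le hkl.symm
  by_cases hm : D.nextFun k = l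
  · rw [hm, gap_self] at b2
    exact absurd (D.gap_lt hkl.symm hne) (not_lt.2 b2)
  have b3 : D.gap k (D.nextFun k) < D.gap k l := lt_of_le_of_ne b1 fun h' =>
    hm (D.eq_of_gap_eq hml.symm h')
  have e2 := D.gap_add (d := l) (e := k) (k := D.nextFun k) (by linarith)
  have := D.gap_pos k (D.nextFun k)
  linarith

/-- The rotation system of a plane drawing: the permutation of the darts that turns each dart
counterclockwise around its start to the following one. -/
noncomputable def next : Equiv.Perm G.Dart :=
  Equiv.ofBijective D.nextFun (Finite.injective_iff_bijective.1 D.nextFun_injective)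

theorem next_fst (d : G.Dart) : (D.next d).fst = d.fst := D.nextFun_fst d

theorem next_pow_fst (d : G.Dart) (n : ℕ) : ((D.next ^ n) d).fst = d.fst := by
  induction n with
  | zero => rfl
  | succ n ih => rw [pow_succ', Equiv.Perm.mul_apply, next_fst, ih]

theorem next_symm_fst (d : G.Dart) : (D.next.symm d).fst = d.fst := by
  rw [← D.next_fst, Equiv.apply_symm_apply]

theorem gap_next_le {d k : G.Dart} (h : k.fst = d.fst) : D.gap d (D.next d) ≤ D.gap d k :=
  D.gap_nextFun_le h

theorem gap_next {d k : G.Dart} (h : k.fst = d.fst) (hne : k ≠ d) :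
    D.gap d (D.next k) = D.gap d k + D.gap k (D.next k) := by
  have := D.gap_next_le h.symm
  have := D.gap_add_gap h hne
  exact (D.gap_add (by linarith)).symm

/-- Among the darts at `v` outside the cycle of `e`, take the one nearest counterclockwise from `e`.
Its predecessor is also outside the cycle, but nearer. -/
theorem next_isCycleOn (v : V) : D.next.IsCycleOn {d | d.fst = v} := by
  classical
  refine ⟨⟨fun d hd => (D.next_fst d).trans hd, D.next.injective.injOn, fun d hd =>
    ⟨D.next.symm d, (D.next_symm_fst d).trans hd, by simp⟩⟩, ?_⟩
  intro e he k hk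
  by_contra hsame
  obtain ⟨m, hm, hmin⟩ := (Finset.univ.filter fun k : G.Dart =>
    k.fst = v ∧ ¬ D.next.SameCycle e k).exists_min_image (D.gap e) ⟨k, by simpa using ⟨hk, hsame⟩⟩
  simp only [Finset.mem_filter, Finset.mem_univ, true_and, and_imp] at hm hmin
  obtain ⟨hmv, hms⟩ := hm
  set p := D.next.symm m with hp
  have hpm : D.next p = m := by simp [hp]
  have hpv : p.fst = v := (D.next_symm_fst m).trans hmv
  have hps : ¬ D.next.SameCycle e p := by
    rw [← hpm, Equiv.Perm.sameCycle_apply_right] at hms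
    exact hms
  have hpe : p ≠ e := by
    rintro rfl
    exact hps (Equiv.Perm.SameCycle.refl _ _)
  have h1 := D.gap_next (hpv.trans he.symm) hpe
  have h2 := hmin p hpv hps
  have h3 := D.gap_pos p (D.next p)
  rw [hpm] at h1 h3
  linarith

theorem next_isCycleOn_filter [DecidableEq V] (v : V) :
    D.next.IsCycleOn ((Finset.univ.filter fun d : G.Dart => d.fst = v : Finset G.Dart) :
      Set G.Dart) := by
  simpa using D.next_isCycleOn v

theorem next_pow_apply_eq [DecidableEq V] {d : G.Dart} {n : ℕ} :
    (D.next ^ n) d = d ↔ G.degree d.fst ∣ n := by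
  rw [(D.next_isCycleOn_filter d.fst).pow_apply_eq (by simp), G.dart_fst_fiber_card_eq_degree]

theorem next_ne [DecidableEq V] {d : G.Dart} (h : 2 ≤ G.degree d.fst) : D.next d ≠ d := by
  intro h'
  have := (D.next_pow_apply_eq (d := d) (n := 1)).1 (by simpa using h')
  have := Nat.le_of_dvd one_pos this
  omega

theorem gap_next_pow_lt [DecidableEq V] {d : G.Dart} {i : ℕ} (hi : 0 < i)
    (h : i < G.degree d.fst) :
    D.gap d ((D.next ^ i) d) < D.gap d ((D.next ^ (i + 1)) d) := by
  have hne : (D.next ^ i) d ≠ d := by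
    rw [Ne, next_pow_apply_eq]
    exact fun h' => absurd (Nat.le_of_dvd hi h') (not_le.2 h)
  rw [pow_succ' D.next i, Equiv.Perm.mul_apply, D.gap_next (D.next_pow_fst d i) hne]
  have := D.gap_pos ((D.next ^ i) d) (D.next ((D.next ^ i) d))
  linarith

/-- The end of a dart, as a neighbour of a vertex that is known to be its start. -/
def endOf {v : V} (d : G.Dart) (h : d.fst = v) : G.neighborSet v :=
  ⟨d.snd, by rw [SimpleGraph.mem_neighborSet, ← h]; exact d.adj⟩

omit [Fintype V] [DecidableRel G.Adj] in
theorem dartOfNeighborSet_endOf {v : V} (d : G.Dart) (h : d.fst = v) :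
    G.dartOfNeighborSet v (endOf d h) = d := by
  subst h
  rfl

/-- Real lifts `f` of the directions that are monotone and span less than a full turn certify the
cyclic order; increasing means counterclockwise. -/
theorem hasStar_of_coe {v : V} (hv : G.degree v = 5) (e : Fin 5 → G.Dart)
    (he : ∀ i, (e i).fst = v) (f : Fin 5 → ℝ) (hf : ∀ i, D.angle (e i) = (f i : Real.Angle))
    (hmono : StrictMono f ∨ StrictAnti f) (hlt : ∀ i j, f i < f j + 2 * π) {κ : Fin 5 → ℕ∞}
    (hκ : ∀ i, (G.degree (e i).snd : ℕ∞) ≤ κ i) : D.HasStar κ := by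
  refine ⟨v, hv, fun i => endOf (e i) (he i), ?_, ?_, hκ⟩
  · intro i j hij
    have h := congrArg (G.dartOfNeighborSet v) hij
    simp only [dartOfNeighborSet_endOf] at h
    have h1 : f i = f j := by
      refine Real.Angle.eq_of_coe_eq_of_abs_sub_lt (by rw [← hf, ← hf, h]) ?_
      have := hlt i j
      have := hlt j i
      rw [abs_lt]
      constructor <;> linarith
    exact hmono.elim (fun h => h.injective h1) fun h => h.injective h1
  · rcases hmono with h | h
    · left
      intro i j l hij hjl
      rw [dartOfNeighborSet_endOf, dartOfNeighborSet_endOf, dartOfNeighborSet_endOf, hf, hf, hf]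
      exact Real.Angle.sbtw_coe (h hij) (h hjl) (hlt _ _)
    · right
      intro i j l hij hjl
      rw [dartOfNeighborSet_endOf, dartOfNeighborSet_endOf, dartOfNeighborSet_endOf, hf, hf, hf]
      exact Real.Angle.sbtw_coe (h hjl) (h hij) (hlt _ _)

/-- The ends of the five darts at a vertex of degree five, taken counterclockwise so that the end
of `d` is the last one, form a star. -/
theorem hasStar_of_next [DecidableEq V] {d : G.Dart} (hd : G.degree d.fst = 5) {κ : Fin 5 → ℕ∞}
    (hκ : ∀ i : Fin 5, (G.degree ((D.next ^ ((i : ℕ) + 1)) d).snd : ℕ∞) ≤ κ i) : D.HasStar κ := by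
  have hmono : StrictMono fun i : Fin 5 => D.gap d ((D.next ^ ((i : ℕ) + 1)) d) := by
    refine Fin.strictMono_iff_lt_succ.2 fun i => ?_
    exact D.gap_next_pow_lt (Nat.succ_pos _) (by rw [hd, Fin.val_castSucc]; omega)
  refine D.hasStar_of_coe hd (fun i => (D.next ^ ((i : ℕ) + 1)) d) (fun i => D.next_pow_fst _ _)
    (fun i => D.gap d ((D.next ^ ((i : ℕ) + 1)) d) + (D.angle d).toReal) ?_
    (Or.inl fun i j hij => by simpa using hmono hij) ?_ hκ
  · intro i
    rw [Real.Angle.coe_add, coe_gap, Real.Angle.coe_toReal]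
    abel
  · intro i j
    have h1 := D.gap_le d ((D.next ^ ((i : ℕ) + 1)) d)
    have h2 := D.gap_pos d ((D.next ^ ((j : ℕ) + 1)) d)
    linarith

/-- The clockwise variant of `hasStar_of_next`. -/
theorem hasStar_of_next_reverse [DecidableEq V] {d : G.Dart} (hd : G.degree d.fst = 5)
    {κ : Fin 5 → ℕ∞}
    (hκ : ∀ i : Fin 5, (G.degree ((D.next ^ (4 - (i : ℕ))) d).snd : ℕ∞) ≤ κ i) :
    D.HasStar κ := by
  -- The last entry is `d` itself, whose gap is 2π; the lift 0 of the same angle keeps `f`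
  -- decreasing.
  set f : Fin 5 → ℝ := fun i => if i = 4 then 0 else D.gap d ((D.next ^ (4 - (i : ℕ))) d) with hf
  have h1 := D.gap_pos d ((D.next ^ 1) d)
  have h2 := D.gap_next_pow_lt (d := d) (i := 1) one_pos (by omega)
  have h3 := D.gap_next_pow_lt (d := d) (i := 2) two_pos (by omega)
  have h4 := D.gap_next_pow_lt (d := d) (i := 3) three_pos (by omega)
  have h5 := D.gap_next_pow_lt (d := d) (i := 4) four_pos (by omega)
  have hanti : StrictAnti f := by
    refine Fin.strictAnti_iff_succ_lt.2 fun i => ?_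
    fin_cases i
    · simpa [hf, Fin.ext_iff] using h4
    · simpa [hf, Fin.ext_iff] using h3
    · simpa [hf, Fin.ext_iff] using h2
    · simpa [hf, Fin.ext_iff] using h1
  refine D.hasStar_of_coe hd (fun i => (D.next ^ (4 - (i : ℕ))) d) (fun i => D.next_pow_fst _ _)
    (fun i => f i + (D.angle d).toReal) ?_ (Or.inr fun i j hij => by simpa using hanti hij) ?_ hκ
  · intro i
    have : (f i : Real.Angle) = (D.gap d ((D.next ^ (4 - (i : ℕ))) d) : Real.Angle) := by
      by_cases hi : i = 4
      · subst hi
        simp [hf, gap_self]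
      · simp only [hf, if_neg hi]
    rw [Real.Angle.coe_add, this, coe_gap, Real.Angle.coe_toReal]
    abel
  · intro i j
    have b1 : f i ≤ f 0 := hanti.antitone (Fin.zero_le i)
    have b2 : f 4 ≤ f j := hanti.antitone (Fin.le_last j)
    have b3 : f 4 = 0 := by simp [hf]
    have b4 : f 0 = D.gap d ((D.next ^ 4) d) := by simp [hf]
    have b5 := D.gap_le d ((D.next ^ 5) d)
    norm_num at h5
    linarith

end Next

end PlaneDrawing

/-! ### Faces, circulations and Euler's inequality -/

namespace PlaneDrawing

open Real

variable {V : Type*} {G : SimpleGraph V} (D : PlaneDrawing G) [Fintype V] [DecidableRel G.Adj]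

/-- The permutation of the darts that follows the boundary of the face on the left of a dart. -/
noncomputable def facePerm : Equiv.Perm G.Dart :=
  (Function.Involutive.toPerm SimpleGraph.Dart.symm SimpleGraph.Dart.symm_involutive).trans
    D.next.symm

theorem facePerm_apply (d : G.Dart) : D.facePerm d = D.next.symm d.symm := rfl

theorem next_facePerm (d : G.Dart) : D.next (D.facePerm d) = d.symm := by
  rw [facePerm_apply, Equiv.apply_symm_apply]

theorem facePerm_fst (d : G.Dart) : (D.facePerm d).fst = d.snd := D.next_symm_fst _

/-- The faces of a plane drawing, as boundary walks: the orbits of `facePerm`. (A face whose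
boundary is disconnected counts once for every boundary component.) -/
abbrev Face : Type _ := Quotient (Equiv.Perm.SameCycle.setoid D.facePerm)

/-- The face on the left of a dart. -/
noncomputable def face (d : G.Dart) : D.Face := Quotient.mk _ d

theorem face_eq_iff {d e : G.Dart} : D.face d = D.face e ↔ D.facePerm.SameCycle d e :=
  Quotient.eq

variable [DecidableEq V]

/-- The circulations of `G`, as functions on the darts. -/
def circulations (G : SimpleGraph V) [DecidableRel G.Adj] : Submodule ℝ (G.Dart → ℝ) where
  carrier := {z | (∀ d, z d.symm = -z d) ∧ ∀ v, ∑ d, (if d.fst = v then z d else 0) = 0}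
  add_mem' := by
    rintro x y ⟨hx, hx'⟩ ⟨hy, hy'⟩
    refine ⟨fun d => by simp [hx, hy, add_comm], fun v => ?_⟩
    have h : ∀ d : G.Dart, (if d.fst = v then (x + y) d else 0)
        = (if d.fst = v then x d else 0) + (if d.fst = v then y d else 0) := by
      intro d
      split_ifs <;> simp
    rw [Finset.sum_congr rfl fun d _ => h d, Finset.sum_add_distrib, hx', hy', add_zero]
  zero_mem' := by simp
  smul_mem' := by
    rintro c x ⟨hx, hx'⟩
    refine ⟨fun d => by simp [hx], fun v => ?_⟩
    have h : ∀ d : G.Dart, (if d.fst = v then (c • x) d else 0)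
        = c * (if d.fst = v then x d else 0) := by
      intro d
      split_ifs <;> simp
    rw [Finset.sum_congr rfl fun d _ => h d, ← Finset.mul_sum, hx', mul_zero]

/-- The left of `facePerm d` is the right of its successor `d.symm`, which is the left of `d`; the
two jumps cancel. -/
theorem flowWinding_facePerm {z : G.Dart → ℝ} (hz : z ∈ circulations G) (d : G.Dart) :
    D.flowWinding z (D.facePerm d) = D.flowWinding z d := by
  have h1 := D.flowWinding_of_next hz.1 hz.2 (d := D.facePerm d) (e := D.next (D.facePerm d))
    (D.next_fst _) (fun k hk => D.gap_next_le hk)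
  have h2 := D.flowWinding_symm hz.1 hz.2 (D.next (D.facePerm d))
  rw [h1, h2, next_facePerm, SimpleGraph.Dart.symm_symm]
  ring

theorem flowWinding_eq_of_sameCycle {z : G.Dart → ℝ} (hz : z ∈ circulations G) {d e : G.Dart}
    (h : D.facePerm.SameCycle d e) : D.flowWinding z e = D.flowWinding z d := by
  obtain ⟨n, -, rfl⟩ := h.exists_pow_eq'
  clear h
  induction n with
  | zero => rfl
  | succ n ih => rw [pow_succ', Equiv.Perm.mul_apply, D.flowWinding_facePerm hz, ih]

/-- The winding numbers of a circulation on chosen darts of all faces. -/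
noncomputable def faceWinding : circulations G →ₗ[ℝ] (D.Face → ℝ) where
  toFun z o := D.flowWinding z.1 o.out
  map_add' x y := by
    funext o
    simp [flowWinding, SegmentSystem.winding, add_mul, Finset.sum_add_distrib]
  map_smul' c x := by
    funext o
    simp [flowWinding, SegmentSystem.winding, mul_assoc, Finset.mul_sum]

/-- If all winding numbers vanish, so do their jumps, which are 4π times the flow. -/
theorem faceWinding_injective : Function.Injective D.faceWinding := by
  rw [injective_iff_map_eq_zero]
  intro z hz
  have hall : ∀ d, D.flowWinding z.1 d = 0 := by
    intro d
    have h1 : D.flowWinding z.1 (D.face d).out = 0 := congrFun hz (D.face d)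
    rw [← h1]
    exact D.flowWinding_eq_of_sameCycle z.2 (D.face_eq_iff.1 (Quotient.out_eq _))
  ext d
  have := D.flowWinding_symm z.2.1 z.2.2 d
  rw [hall, hall, zero_add] at this
  have hpi := Real.pi_pos
  simpa [hpi.ne'] using this.symm

/-- Orient every edge by `o` and extend edge functions antisymmetrically. Divergences sum to zero
over all vertices, so the divergence map has rank below V, and rank-nullity bounds its kernel from
below. -/
theorem card_edgeFinset_add_one_le_finrank_circulations [Nonempty V] :
    G.edgeFinset.card + 1 ≤ Fintype.card V + Module.finrank ℝ (circulations G) := by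
  classical
  have hex : ∀ e : G.edgeSet, ∃ d : G.Dart, d.edge = e := by
    rintro ⟨e, he⟩
    induction e with
    | h a b => exact ⟨⟨(a, b), he⟩, rfl⟩
  choose o ho using hex
  let ext : (G.edgeSet → ℝ) →ₗ[ℝ] (G.Dart → ℝ) :=
    { toFun := fun y d => if o ⟨d.edge, d.edge_mem⟩ = d then y ⟨d.edge, d.edge_mem⟩
        else -y ⟨d.edge, d.edge_mem⟩
      map_add' := by
        intro x y; funext d; simp only [Pi.add_apply]; split_ifs <;> ring
      map_smul' := by
        intro c x; funext d; simp only [Pi.smul_apply, smul_eq_mul, RingHom.id_apply]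
        split_ifs <;> ring }
  have hext : ∀ y e, ext y (o e) = y e := by
    intro y e
    have : (⟨(o e).edge, (o e).edge_mem⟩ : G.edgeSet) = e := Subtype.ext (ho e)
    simp only [ext, LinearMap.coe_mk, AddHom.coe_mk, this, if_true]
  have hanti : ∀ y (d : G.Dart), ext y d.symm = -ext y d := by
    intro y d
    have he : (⟨d.symm.edge, d.symm.edge_mem⟩ : G.edgeSet) = ⟨d.edge, d.edge_mem⟩ :=
      Subtype.ext d.edge_symm
    simp only [ext, LinearMap.coe_mk, AddHom.coe_mk, he]
    have h2 := ho ⟨d.edge, d.edge_mem⟩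
    rcases (SimpleGraph.dart_edge_eq_iff _ _).1 h2 with h | h
    · rw [if_pos h, if_neg]
      rw [h]
      exact d.symm_ne.symm
    · rw [if_pos h, if_neg, neg_neg]
      rw [h]
      exact d.symm_ne
  let div : (G.Dart → ℝ) →ₗ[ℝ] (V → ℝ) :=
    { toFun := fun z v => ∑ d, (if d.fst = v then z d else 0)
      map_add' := by
        intro x y; funext v
        simp only [Pi.add_apply, ← Finset.sum_add_distrib]
        exact Finset.sum_congr rfl fun d _ => by split_ifs <;> simp
      map_smul' := by
        intro c x; funext v
        simp only [Pi.smul_apply, smul_eq_mul, RingHom.id_apply, Finset.mul_sum]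
        exact Finset.sum_congr rfl fun d _ => by split_ifs <;> simp }
  have hsum : ∀ y, ∑ v, div (ext y) v = 0 := by
    intro y
    have h1 : ∑ v, div (ext y) v = ∑ d, ext y d := by
      simp only [div, LinearMap.coe_mk, AddHom.coe_mk]
      rw [Finset.sum_comm]
      simp
    have h2 : ∑ d : G.Dart, ext y d = -∑ d : G.Dart, ext y d := by
      rw [← Finset.sum_neg_distrib]
      exact Finset.sum_nbij' SimpleGraph.Dart.symm SimpleGraph.Dart.symm (by simp) (by simp)
        (by simp) (by simp) (fun d _ => by rw [hanti, neg_neg])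
    rw [h1]
    linarith
  have hrange : Module.finrank ℝ (LinearMap.range (div ∘ₗ ext)) < Fintype.card V := by
    rw [← Module.finrank_fintype_fun_eq_card ℝ (η := V)]
    refine Submodule.finrank_lt ?_
    intro htop
    obtain ⟨v⟩ := ‹Nonempty V›
    have : Pi.single v (1 : ℝ) ∈ LinearMap.range (div ∘ₗ ext) := by rw [htop]; trivial
    obtain ⟨y, hy⟩ := this
    have h3 := hsum y
    rw [LinearMap.comp_apply] at hy
    rw [hy] at h3
    simp at h3
  have hker : Module.finrank ℝ (LinearMap.ker (div ∘ₗ ext))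
      ≤ Module.finrank ℝ (circulations G) := by
    refine LinearMap.finrank_le_finrank_of_injective
      (f := (ext.domRestrict (LinearMap.ker (div ∘ₗ ext))).codRestrict (circulations G) ?_) ?_
    · rintro ⟨y, hy⟩
      exact ⟨hanti y, fun v => congrFun hy v⟩
    · rintro ⟨x, hx⟩ ⟨y, hy⟩ h
      have h' : ext x = ext y := congrArg Subtype.val h
      refine Subtype.ext (funext fun e => ?_)
      exact (hext x e).symm.trans ((congrFun h' _).trans (hext y e))
  have hrn := LinearMap.finrank_range_add_finrank_ker (div ∘ₗ ext)
  rw [Module.finrank_fintype_fun_eq_card, ← SimpleGraph.edgeFinset_card] at hrn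
  omega

noncomputable instance : Fintype D.Face := Fintype.ofFinite _

/-- One half of Euler's formula for plane graphs. -/
theorem card_edgeFinset_add_one_le [Nonempty V] :
    G.edgeFinset.card + 1 ≤ Fintype.card V + Fintype.card D.Face := by
  have h1 := card_edgeFinset_add_one_le_finrank_circulations (G := G)
  have h2 := LinearMap.finrank_le_finrank_of_injective D.faceWinding_injective
  rw [Module.finrank_fintype_fun_eq_card] at h2
  omega

end PlaneDrawing

/-! ### Discharging -/

namespace PlaneDrawing

variable {V : Type*} {G : SimpleGraph V} (D : PlaneDrawing G) [Fintype V] [DecidableRel G.Adj]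
  [DecidableEq V]

open Classical in
/-- The number of darts on the boundary walk of the face on the left of a dart. -/
noncomputable def faceLength (d : G.Dart) : ℕ :=
  (Finset.univ.filter fun e => D.face e = D.face d).card

-- A facial walk of length l consists of l darts, contributing 1/l each.
omit [DecidableEq V] in
theorem sum_inv_faceLength : ∑ d, (1 : ℝ) / D.faceLength d = Fintype.card D.Face := by
  classical
  rw [← Finset.sum_fiberwise (s := Finset.univ) (g := D.face)]
  have : ∀ o : D.Face, ∑ d ∈ Finset.univ.filter (fun d => D.face d = o),
      (1 : ℝ) / D.faceLength d = 1 := by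
    intro o
    obtain ⟨d, rfl⟩ := Quotient.exists_rep o
    have h : ∀ e ∈ Finset.univ.filter (fun e => D.face e = D.face d),
        (1 : ℝ) / D.faceLength e = 1 / D.faceLength d := by
      intro e he
      simp only [faceLength, (Finset.mem_filter.1 he).2]
    change ∑ e ∈ Finset.univ.filter (fun e => D.face e = D.face d), _ = _
    rw [Finset.sum_congr rfl h, Finset.sum_const, nsmul_eq_mul]
    have hpos : (Finset.univ.filter fun e => D.face e = D.face d).card ≠ 0 :=
      Finset.card_ne_zero_of_mem (a := d) (by simp)
    have hc : D.faceLength d = (Finset.univ.filter fun e => D.face e = D.face d).card := by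
      simp only [faceLength]
    rw [hc]
    field_simp
  rw [Finset.sum_congr rfl fun o _ => this o]
  simp

theorem facePerm_pow_faceLength (d : G.Dart) : (D.facePerm ^ D.faceLength d) d = d := by
  classical
  refine Equiv.Perm.IsCycleOn.pow_card_apply ?_ (by simp)
  have hset : ((Finset.univ.filter fun e => D.face e = D.face d : Finset G.Dart) : Set G.Dart)
      = {e | D.facePerm.SameCycle d e} := by
    ext e
    simp [face_eq_iff, Equiv.Perm.sameCycle_comm]
  rw [hset]
  refine ⟨⟨fun e he => Equiv.Perm.sameCycle_apply_right.2 he, D.facePerm.injective.injOn,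
    fun e he => ⟨D.facePerm.symm e, ?_, by simp⟩⟩, fun x hx y hy => hx.symm.trans hy⟩
  exact Equiv.Perm.sameCycle_symm_apply_right.2 he

omit [DecidableEq V] in
theorem facePerm_ne (d : G.Dart) : D.facePerm d ≠ d := by
  intro h
  have := D.facePerm_fst d
  rw [h] at this
  exact d.fst_ne_snd this

/-- A facial walk of length two would run back along the same edge, as the graph is simple; this
happens only at a vertex of degree one. -/
theorem facePerm_facePerm_ne {d : G.Dart} (h : 2 ≤ G.degree d.snd) :
    D.facePerm (D.facePerm d) ≠ d := by
  intro h'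
  have h1 : D.facePerm d = d.symm := by
    refine SimpleGraph.Dart.ext _ _ (Prod.ext (D.facePerm_fst d) ?_)
    rw [← facePerm_fst, h']
    rfl
  have h2 := D.next_facePerm d
  rw [h1] at h2
  exact D.next_ne (d := d.symm) h h2

theorem three_le_faceLength {d : G.Dart} (h : 2 ≤ G.degree d.snd) : 3 ≤ D.faceLength d := by
  have h0 := D.facePerm_pow_faceLength d
  have hpos : D.faceLength d ≠ 0 := Finset.card_ne_zero_of_mem (a := d) (by simp)
  by_contra hlt
  have : D.faceLength d = 1 ∨ D.faceLength d = 2 := by omega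
  rcases this with h1 | h1
  · rw [h1] at h0
    exact D.facePerm_ne d (by simpa using h0)
  · rw [h1] at h0
    exact D.facePerm_facePerm_ne h (by simpa [pow_succ] using h0)

/-- At a triangular corner, the neighbour following the end `w` of `d` in the rotation is also
the one preceding the start of `d` in the rotation around `w`. -/
theorem next_snd_of_triangle {d : G.Dart} (h : D.faceLength d = 3) :
    (D.next d).snd = (D.next.symm d.symm).snd := by
  have h0 := D.facePerm_pow_faceLength d
  rw [h] at h0
  have h1 : D.facePerm (D.facePerm (D.facePerm d)) = d := by simpa [pow_succ] using h0
  have h2 := D.next_facePerm (D.facePerm (D.facePerm d))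
  rw [h1] at h2
  rw [h2]
  exact D.facePerm_fst _

/-- This is the mirror image of `next_snd_of_triangle`: the face to the left of `next.symm d` lies
to the right of `d`. -/
theorem next_symm_snd_of_triangle {d : G.Dart} (h : D.faceLength (D.next.symm d) = 3) :
    (D.next.symm d).snd = (D.next d.symm).snd := by
  set p := D.next.symm d with hp
  have hpd : D.next p = d := by simp [hp]
  have h0 := D.facePerm_pow_faceLength p
  rw [h] at h0
  have h1 : D.facePerm (D.facePerm (D.facePerm p)) = p := by simpa [pow_succ] using h0
  have h2 := D.next_facePerm (D.facePerm (D.facePerm p))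
  rw [h1, hpd] at h2
  have h3 := D.next_facePerm (D.facePerm p)
  rw [h2, SimpleGraph.Dart.symm_symm, h3]
  exact (D.facePerm_fst p).symm

/-- The charge that the corner to the left of the start of a dart receives from its face. -/
noncomputable def cornerCharge (d : G.Dart) : ℝ := 2 - 6 / D.faceLength d

theorem cornerCharge_nonneg {d : G.Dart} (h : 2 ≤ G.degree d.snd) : 0 ≤ D.cornerCharge d := by
  have h3 : (3 : ℝ) ≤ D.faceLength d := by exact_mod_cast D.three_le_faceLength h
  rw [cornerCharge, sub_nonneg, div_le_iff₀ (by linarith)]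
  linarith

theorem half_le_cornerCharge {d : G.Dart} (h : 2 ≤ G.degree d.snd) (hne : D.faceLength d ≠ 3) :
    1 / 2 ≤ D.cornerCharge d := by
  have h3 := D.three_le_faceLength h
  have h4 : (4 : ℝ) ≤ D.faceLength d := by
    have : 4 ≤ D.faceLength d := by omega
    exact_mod_cast this
  have : 6 / (D.faceLength d : ℝ) ≤ 3 / 2 := by
    rw [div_le_iff₀ (by linarith)]
    linarith
  rw [cornerCharge]
  linarith

theorem sum_fst_fiberwise (f : G.Dart → ℝ) :
    ∑ v, ∑ d ∈ Finset.univ.filter (fun d : G.Dart => d.fst = v), f d = ∑ d, f d :=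
  Finset.sum_fiberwise _ _ _

theorem sum_charge_neg [Nonempty V] :
    ∑ v, ((G.degree v : ℝ) - 6) + ∑ d, D.cornerCharge d < 0 := by
  have h1 : ∑ v, (G.degree v : ℝ) = 2 * G.edgeFinset.card := by
    exact_mod_cast G.sum_degrees_eq_twice_card_edges
  have h2 : (Fintype.card G.Dart : ℝ) = 2 * G.edgeFinset.card := by
    exact_mod_cast G.dart_card_eq_twice_card_edges
  have h3 : (G.edgeFinset.card : ℝ) + 1 ≤ Fintype.card V + Fintype.card D.Face := by
    exact_mod_cast D.card_edgeFinset_add_one_le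
  have h4 : ∑ d, D.cornerCharge d = 2 * Fintype.card G.Dart - 6 * Fintype.card D.Face := by
    rw [← sum_inv_faceLength, Finset.mul_sum]
    simp only [cornerCharge, Finset.sum_sub_distrib]
    simp [mul_comm, div_eq_mul_inv]
  rw [Finset.sum_sub_distrib, h1, h4, h2]
  simp
  linarith

/-- The charge that a vertex of degree at least twelve sends along each of its edges. -/
noncomputable def share (G : SimpleGraph V) [DecidableRel G.Adj] (w : V) : ℝ :=
  if 12 ≤ G.degree w then ((G.degree w : ℝ) - 6) / G.degree w else 0

omit [DecidableEq V] in
theorem share_nonneg (w : V) : 0 ≤ share G w := by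
  rw [share]
  split_ifs with h
  · have : (12 : ℝ) ≤ G.degree w := by exact_mod_cast h
    exact div_nonneg (by linarith) (by linarith)
  · exact le_rfl

omit [DecidableEq V] in
theorem half_le_share {w : V} (h : 12 ≤ G.degree w) : 1 / 2 ≤ share G w := by
  have : (12 : ℝ) ≤ G.degree w := by exact_mod_cast h
  rw [share, if_pos h, le_div_iff₀ (by linarith)]
  linarith

omit [DecidableEq V] in
theorem two_thirds_le_share {w : V} (h : 18 ≤ G.degree w) : 2 / 3 ≤ share G w := by
  have : (18 : ℝ) ≤ G.degree w := by exact_mod_cast h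
  rw [share, if_pos (by omega), le_div_iff₀ (by linarith)]
  linarith

/-- The indicator that the end of a dart has degree `k`. -/
noncomputable def endDegree (G : SimpleGraph V) [DecidableRel G.Adj] (k : ℕ) (d : G.Dart) : ℝ :=
  if G.degree d.snd = k then 1 else 0

omit [DecidableEq V] in
theorem endDegree_nonneg (k : ℕ) (d : G.Dart) : 0 ≤ endDegree G k d := by
  rw [endDegree]
  split_ifs <;> simp

/-- The charge that the start of `d` receives from the end `w` of `d` if the start has degree
five: the share of `w` along `d`, and half of the share along each of the two edges that are
next to `d` in the rotation around `w` and lead to a vertex of degree six. -/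
noncomputable def transfer (d : G.Dart) : ℝ :=
  share G d.snd * (1 + endDegree G 6 (D.next d.symm) / 2 + endDegree G 6 (D.next.symm d.symm) / 2)

omit [DecidableEq V] in
theorem share_le_transfer (d : G.Dart) : share G d.snd ≤ D.transfer d := by
  have h1 := share_nonneg (G := G) d.snd
  have h2 := endDegree_nonneg 6 (D.next d.symm)
  have h3 := endDegree_nonneg 6 (D.next.symm d.symm)
  rw [transfer]
  nlinarith [mul_nonneg h1 h2, mul_nonneg h1 h3]

omit [DecidableEq V] in
theorem transfer_nonneg (d : G.Dart) : 0 ≤ D.transfer d :=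
  (share_nonneg _).trans (D.share_le_transfer d)

/-- Each edge at a large vertex pays its share at most once: whole to an end of degree 5, or in two
halves past an end of degree 6. -/
theorem sum_transfer_le :
    ∑ d, (if G.degree d.fst = 5 then D.transfer d else 0)
      ≤ ∑ v, (if 12 ≤ G.degree v then (G.degree v : ℝ) - 6 else 0) := by
  -- Reversing all darts indexes the payments by their senders.
  have h1 : ∑ d, (if G.degree d.fst = 5 then D.transfer d else 0)
      = ∑ d : G.Dart, share G d.fst * (endDegree G 5 d * (1 + endDegree G 6 (D.next d) / 2
        + endDegree G 6 (D.next.symm d) / 2)) := by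
    refine Finset.sum_nbij' SimpleGraph.Dart.symm SimpleGraph.Dart.symm (by simp) (by simp)
      (by simp) (by simp) fun d _ => ?_
    by_cases h : G.degree d.fst = 5
    · have : endDegree G 5 d.symm = 1 := if_pos h
      rw [if_pos h, this, transfer, one_mul]
      rfl
    · have : endDegree G 5 d.symm = 0 := if_neg h
      rw [if_neg h, this]
      ring
  have h2 : ∀ d : G.Dart, share G d.fst * (endDegree G 5 d * (1 + endDegree G 6 (D.next d) / 2
        + endDegree G 6 (D.next.symm d) / 2))
      ≤ share G d.fst * endDegree G 5 d + share G d.fst * endDegree G 6 (D.next d) / 2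
        + share G d.fst * endDegree G 6 (D.next.symm d) / 2 := by
    intro d
    have e1 := share_nonneg (G := G) d.fst
    have e2 := mul_nonneg e1 (endDegree_nonneg 6 (D.next d))
    have e3 := mul_nonneg e1 (endDegree_nonneg 6 (D.next.symm d))
    rw [endDegree.eq_def G 5 d]
    split_ifs
    · linarith
    · linarith
  have h3 : ∑ d : G.Dart, share G d.fst * endDegree G 6 (D.next d)
      = ∑ d : G.Dart, share G d.fst * endDegree G 6 d := by
    rw [← Equiv.sum_comp D.next fun d : G.Dart => share G d.fst * endDegree G 6 d]
    simp only [next_fst]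
  have h4 : ∑ d : G.Dart, share G d.fst * endDegree G 6 (D.next.symm d)
      = ∑ d : G.Dart, share G d.fst * endDegree G 6 d := by
    rw [← Equiv.sum_comp D.next.symm fun d : G.Dart => share G d.fst * endDegree G 6 d]
    simp only [next_symm_fst]
  have h5 : ∑ d : G.Dart, share G d.fst
      = ∑ v, (if 12 ≤ G.degree v then (G.degree v : ℝ) - 6 else 0) := by
    rw [← sum_fst_fiberwise]
    refine Finset.sum_congr rfl fun v _ => ?_
    rw [Finset.sum_congr rfl (g := fun _ => share G v)
      (fun d hd => by rw [(Finset.mem_filter.1 hd).2]), Finset.sum_const,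
      G.dart_fst_fiber_card_eq_degree, nsmul_eq_mul, share]
    split_ifs with h
    · have : (G.degree v : ℝ) ≠ 0 := by
        norm_cast
        omega
      field_simp
    · simp
  rw [h1, ← h5]
  refine (Finset.sum_le_sum fun d _ => h2 d).trans ?_
  rw [Finset.sum_add_distrib, Finset.sum_add_distrib, ← Finset.sum_div, ← Finset.sum_div, h3, h4,
    add_assoc, add_halves, ← Finset.sum_add_distrib]
  refine Finset.sum_le_sum fun d _ => ?_
  have e1 := share_nonneg (G := G) d.fst
  have e2 : endDegree G 5 d + endDegree G 6 d ≤ 1 := by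
    rw [endDegree, endDegree]
    split_ifs with h h'
    · omega
    all_goals norm_num
  nlinarith

/-- If the only neighbour of large degree of a vertex of degree five is the end of `d`, and both
corners next to `d` are triangular, then the transfer along `d` suffices. -/
theorem one_le_transfer (hmin : ∀ v, 5 ≤ G.degree v)
    (hdeg : ∀ v, ¬(7 ≤ G.degree v ∧ G.degree v ≤ 11)) (h1 : ¬D.HasStar ![5, 6, 6, 5, ⊤])
    (h2 : ¬D.HasStar ![5, 6, 6, 6, 17])
    {d : G.Dart} (hd5 : G.degree d.fst = 5) (hbig : 12 ≤ G.degree d.snd)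
    (hother : ∀ e : G.Dart, e.fst = d.fst → e ≠ d → G.degree e.snd < 12)
    (htri : ∀ e : G.Dart, e.fst = d.fst → D.faceLength e = 3) : 1 ≤ D.transfer d := by
  have h5 : (D.next ^ 5) d = d := D.next_pow_apply_eq.2 (by rw [hd5])
  have hle : ∀ i, 0 < i → i < 5 → G.degree ((D.next ^ i) d).snd ≤ 6 := by
    intro i hi hi5
    have hne : (D.next ^ i) d ≠ d := by
      rw [Ne, next_pow_apply_eq, hd5]
      exact fun h => absurd (Nat.le_of_dvd hi h) (by omega)
    have := hother _ (D.next_pow_fst d i) hne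
    have := hdeg ((D.next ^ i) d).snd
    omega
  have h4 : D.next.symm d = (D.next ^ 4) d := by
    rw [Equiv.symm_apply_eq, ← Equiv.Perm.mul_apply, ← pow_succ', h5]
  have hx : (D.next.symm d.symm).snd = ((D.next ^ 1) d).snd := by
    rw [← D.next_snd_of_triangle (htri d rfl), pow_one]
  have hx' : (D.next d.symm).snd = ((D.next ^ 4) d).snd := by
    rw [← D.next_symm_snd_of_triangle (htri _ (D.next_symm_fst d)), h4]
  have b1 := hle 1 (by omega) (by omega)
  have b2 := hle 2 (by omega) (by omega)
  have b3 := hle 3 (by omega) (by omega)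
  have b4 := hle 4 (by omega) (by omega)
  have c1 := hmin ((D.next ^ 1) d).snd
  have c4 := hmin ((D.next ^ 4) d).snd
  have hs := half_le_share hbig
  have a1 : (G.degree ((D.next ^ 1) d).snd : ℕ∞) ≤ 6 := by exact_mod_cast b1
  have a2 : (G.degree ((D.next ^ 2) d).snd : ℕ∞) ≤ 6 := by exact_mod_cast b2
  have a3 : (G.degree ((D.next ^ 3) d).snd : ℕ∞) ≤ 6 := by exact_mod_cast b3
  have a4 : (G.degree ((D.next ^ 4) d).snd : ℕ∞) ≤ 6 := by exact_mod_cast b4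
  have five : ∀ {n : ℕ}, n ≤ 6 → n ≠ 6 → (n : ℕ∞) ≤ 5 := fun h h' => by
    exact_mod_cast (show _ ≤ 5 by omega)
  have seventeen : ¬18 ≤ G.degree d.snd → (G.degree d.snd : ℕ∞) ≤ 17 := fun h => by
    exact_mod_cast (show _ ≤ 17 by omega)
  rw [transfer, endDegree, endDegree, hx, hx']
  -- The transfer is the share of `d.snd` times 2, 3/2 or 1, as two, one or none of the neighbours
  -- beside it have degree 6. With exactly one, the orientation of the star puts the other
  -- neighbour, of degree 5, first.
  by_cases e1 : G.degree ((D.next ^ 1) d).snd = 6 <;>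
    by_cases e4 : G.degree ((D.next ^ 4) d).snd = 6
  · rw [if_pos e1, if_pos e4]
    linarith
  · have h18 : 18 ≤ G.degree d.snd := by
      by_contra hlt
      refine h2 (D.hasStar_of_next_reverse hd5 fun i => ?_)
      fin_cases i
      · exact five b4 e4
      · exact a3
      · exact a2
      · exact a1
      · exact seventeen hlt
    have := two_thirds_le_share h18
    rw [if_pos e1, if_neg e4]
    linarith
  · have h18 : 18 ≤ G.degree d.snd := by
      by_contra hlt
      refine h2 (D.hasStar_of_next hd5 fun i => ?_)
      fin_cases i
      · exact five b1 e1
      · exact a2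
      · exact a3
      · exact a4
      · change (G.degree ((D.next ^ 5) d).snd : ℕ∞) ≤ 17
        rw [h5]
        exact seventeen hlt
    have := two_thirds_le_share h18
    rw [if_neg e1, if_pos e4]
    linarith
  · exfalso
    refine h1 (D.hasStar_of_next hd5 fun i => ?_)
    fin_cases i
    · exact five b1 e1
    · exact a2
    · exact a3
    · exact five b4 e4
    · exact le_top

/-- Without stars of the three kinds, a vertex of degree five receives enough charge. -/
theorem one_le_sum_received (hmin : ∀ v, 5 ≤ G.degree v)
    (hdeg : ∀ v, ¬(7 ≤ G.degree v ∧ G.degree v ≤ 11)) (h1 : ¬D.HasStar ![5, 6, 6, 5, ⊤])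
    (h2 : ¬D.HasStar ![5, 6, 6, 6, 17]) (h3 : ¬D.HasStar ![6, 6, 6, 6, 6]) {v : V}
    (hv : G.degree v = 5) :
    1 ≤ ∑ d ∈ Finset.univ.filter (fun d : G.Dart => d.fst = v), (D.cornerCharge d + D.transfer d)
    := by
  have hc : ∀ d, 0 ≤ D.cornerCharge d := fun d =>
    D.cornerCharge_nonneg (by have := hmin d.snd; omega)
  have hpos : ∀ d ∈ Finset.univ.filter (fun d : G.Dart => d.fst = v),
      0 ≤ D.cornerCharge d + D.transfer d := fun d _ =>
    add_nonneg (hc d) (D.transfer_nonneg d)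
  obtain ⟨d, rfl, hbig⟩ : ∃ d : G.Dart, d.fst = v ∧ 12 ≤ G.degree d.snd := by
    by_contra hno
    push Not at hno
    obtain ⟨d, hd⟩ : (Finset.univ.filter (fun d : G.Dart => d.fst = v)).Nonempty := by
      rw [← Finset.card_pos, G.dart_fst_fiber_card_eq_degree]
      omega
    have hdv : d.fst = v := (Finset.mem_filter.1 hd).2
    refine h3 (D.hasStar_of_next (d := d) (by rw [hdv, hv]) fun i => ?_)
    have e1 := hno _ ((D.next_pow_fst d (i + 1)).trans hdv)
    have e2 := hdeg ((D.next ^ ((i : ℕ) + 1)) d).snd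
    have e3 : G.degree ((D.next ^ ((i : ℕ) + 1)) d).snd ≤ 6 := by omega
    have e4 : (![6, 6, 6, 6, 6] : Fin 5 → ℕ∞) i = 6 := by fin_cases i <;> rfl
    rw [e4]
    exact_mod_cast e3
  have hmem : d ∈ Finset.univ.filter (fun e : G.Dart => e.fst = d.fst) := by simp
  have hself := Finset.single_le_sum hpos hmem
  have hd12 := (half_le_share hbig).trans (D.share_le_transfer d)
  by_cases hother : ∀ e : G.Dart, e.fst = d.fst → e ≠ d → G.degree e.snd < 12
  · by_cases htri : ∀ e : G.Dart, e.fst = d.fst → D.faceLength e = 3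
    · have := D.one_le_transfer hmin hdeg h1 h2 hv hbig hother htri
      have := hc d
      linarith
    · push Not at htri
      obtain ⟨e, he, hne⟩ := htri
      have hq := D.half_le_cornerCharge (d := e) (by have := hmin e.snd; omega) hne
      have hmem' : e ∈ Finset.univ.filter (fun e : G.Dart => e.fst = d.fst) := by simpa using he
      rw [Finset.sum_add_distrib]
      have s1 := Finset.single_le_sum (f := D.cornerCharge) (fun d _ => hc d) hmem'
      have s2 := Finset.single_le_sum (f := D.transfer) (fun d _ => D.transfer_nonneg d) hmem
      linarith
  · push Not at hother
    obtain ⟨e, he, hne, hbig'⟩ := hother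
    have he12 := (half_le_share hbig').trans (D.share_le_transfer e)
    have hmem' : e ∈ Finset.univ.filter (fun e : G.Dart => e.fst = d.fst) := by simpa using he
    have := Finset.add_le_sum hpos hmem hmem' hne.symm
    have := hc d
    have := hc e
    linarith

end PlaneDrawing

theorem theorem10 {V : Type*} [Fintype V] (G : SimpleGraph V) [DecidableRel G.Adj]
    (D : PlaneDrawing G) (hmin : G.minDegree = 5)
    (hdeg : ∀ v : V, ¬ (7 ≤ G.degree v ∧ G.degree v ≤ 11)) :
    D.HasStar ![5, 6, 6, 5, ⊤] ∨ D.HasStar ![5, 6, 6, 6, 17] ∨ D.HasStar ![6, 6, 6, 6, 6] := by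
  classical
  by_contra hstar
  push Not at hstar
  obtain ⟨h1, h2, h3⟩ := hstar
  have hmin' : ∀ v, 5 ≤ G.degree v := fun v => hmin ▸ G.minDegree_le_degree v
  have : Nonempty V := by
    by_contra h
    rw [not_nonempty_iff] at h
    simp at hmin
  have hneg := D.sum_charge_neg
  have htr := D.sum_transfer_le
  rw [← PlaneDrawing.sum_fst_fiberwise] at hneg htr
  -- What a vertex may give away is at most its charge plus what it receives; summed over all
  -- vertices, this contradicts the negative total.
  have hv : ∀ v, (if 12 ≤ G.degree v then (G.degree v : ℝ) - 6 else 0)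
      ≤ ((G.degree v : ℝ) - 6)
        + ∑ d ∈ Finset.univ.filter (fun d : G.Dart => d.fst = v), D.cornerCharge d
        + ∑ d ∈ Finset.univ.filter (fun d : G.Dart => d.fst = v),
          (if G.degree d.fst = 5 then D.transfer d else 0) := by
    intro v
    have hc : 0 ≤ ∑ d ∈ Finset.univ.filter (fun d : G.Dart => d.fst = v), D.cornerCharge d :=
      Finset.sum_nonneg fun d _ => D.cornerCharge_nonneg (by have := hmin' d.snd; omega)
    have ht : ∑ d ∈ Finset.univ.filter (fun d : G.Dart => d.fst = v),
          (if G.degree d.fst = 5 then D.transfer d else 0)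
        = if G.degree v = 5 then
          ∑ d ∈ Finset.univ.filter (fun d : G.Dart => d.fst = v), D.transfer d else 0 := by
      split_ifs with h
      · exact Finset.sum_congr rfl fun d hd => if_pos (by rw [(Finset.mem_filter.1 hd).2, h])
      · exact Finset.sum_eq_zero fun d hd => if_neg (by rwa [(Finset.mem_filter.1 hd).2])
    rw [ht]
    by_cases h5 : G.degree v = 5
    · have := D.one_le_sum_received hmin' hdeg h1 h2 h3 h5
      rw [Finset.sum_add_distrib] at this
      rw [if_neg (by omega), if_pos h5, h5]
      push_cast
      linarith
    · rw [if_neg h5]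
      split_ifs with h12
      · linarith
      · have : (6 : ℝ) ≤ G.degree v := by
          have := hmin' v
          have : 6 ≤ G.degree v := by omega
          exact_mod_cast this
        linarith
  have hsum := Finset.sum_le_sum fun v (_ : v ∈ Finset.univ) => hv v
  rw [Finset.sum_add_distrib, Finset.sum_add_distrib] at hsum
  linarith
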